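/- Let $N\ge 1$ be an integer, $\gamma,\delta\in\mathbb{R}$ not both zero, $\lambda_1=\lambda_{1R}+\mathrm{i}\lambda_{1I}\in\mathbb{C}$ with $\lambda_{1I}>0$, and $a_1^{[0]},\dots,a_1^{[N-1]}\in\mathbb{C}$. For $x,t\in\mathbb{R}$ and $\lambda\in\mathbb{C}$ put $$\theta(\lambda)=\mathrm{i}\lambda\bigl(x+(2\gamma\lambda+4\delta\lambda^2)t\bigr)+\sum_{j=0}^{N-1}a_1^{[j]}(\lambda-\lambda_1)^j-\tfrac{\mathrm{i}\pi}{4},\qquad \theta_1=\theta(\lambda_1),$$ and define $f_l=f_l(x,t)$ by the expansion $\exp\bigl(2\theta(\lambda_1+\mathrm{i}\epsilon)-2\theta_1\bigr)=\sum_{l\ge0}f_l\,\epsilon^l$. Let $\mathbf{F}$ be the $N\times N$ upper triangular Toeplitz matrix with entries $\mathrm{e}^{2\theta_1}f_{j-i}$ for $i\le j$ and $0$ otherwise, let $\mathbf{F}_{1}$ be its first row, $\mathbf{e}_1=[1,0,\dots,0]$, and $$\mathbf{B}=\left(\frac{1}{\lambda_1-\lambda_1^*}\binom{i+j-2}{i-1}\Bigl(\frac{\mathrm{i}}{\lambda_1^*-\lambda_1}\Bigr)^{i+j-2}\right)_{1\le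 i,j\le N},\qquad \mathbf{M}=\mathbf{F}^\dagger\mathbf{B}\mathbf{F}+\mathbf{B},\qquad \mathbf{G}=\begin{bmatrix}\mathbf{M}&\mathbf{F}_1^\dagger\\ \mathbf{e}_1&0\end{bmatrix}.$$ Then $\det\mathbf{M}\ne0$ for all $(x,t)\in\mathbb{R}^2$. Let $$q^{[N]}(x,t)=2\,\frac{\det\mathbf{G}}{\det\mathbf{M}},$$ the $N$-th order soliton of the Hirota equation $\mathrm{i}q_t+\gamma(q_{xx}+2|q|^2q)+\mathrm{i}\delta(q_{xxx}+6|q|^2q_x)=0$ with the single spectral parameter $\lambda_1$. Put $$v_1=-4\left(\lambda_{1R}\gamma-\lambda_{1I}^2\delta+3\lambda_{1R}^2\delta\right),\qquad \mathscr{C}_1=16\delta\lambda_{1I}^2+8\mathrm{i}\gamma\lambda_{1I}+48\mathrm{i}\delta\lambda_{1R}\lambda_{1I},$$ $$\Delta^{[\kappa]}=\log\frac{(N-\kappa)!}{(\kappa-1)!}-(N+1-2\kappa)\bigl(\log(2\lambda_{1I})+\log|\mathscr{C}_1|\bigr),$$ $$s_{l,\pm}^{[\kappa]}=x\mp\frac{N+1-2\kappa}{2\lambda_{1I}}\log|t|-v_1t,\qquad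 s_{r,\pm}^{[\kappa]}=x\pm\frac{N+1-2\kappa}{2\lambda_{1I}}\log|t|-v_1t.$$ Then, as $t\to\pm\infty$ (upper signs for $t\to+\infty$, lower signs for $t\to-\infty$), $$\begin{aligned}q^{[N]}(x,t)=&\sum_{\kappa=1}^{\lfloor (N+1)/2\rfloor}2\lambda_{1I}\,\mathrm{sech}\bigl(2\lambda_{1I}s_{l,\pm}^{[\kappa]}\pm\Delta^{[\kappa]}-2\,\mathrm{Re}\,a_1^{[0]}\bigr)\,\mathrm{e}^{-2\mathrm{i}\,\mathrm{Im}(\theta_1)\pm\mathrm{i}(N+1-2\kappa)\arg\mathscr{C}_1+\mathrm{i}\pi(\frac12+\kappa)}\\&+\sum_{\kappa=1}^{\lfloor N/2\rfloor}2\lambda_{1I}\,\mathrm{sech}\bigl(2\lambda_{1I}s_{r,\pm}^{[\kappa]}\mp\Delta^{[\kappa]}-2\,\mathrm{Re}\,a_1^{[0]}\bigr)\,\mathrm{e}^{-2\mathrm{i}\,\mathrm{Im}(\theta_1)\mp\mathrm{i}(N+1-2\kappa)\arg\mathscr{C}_1+\mathrm{i}\pi(N-\frac12+\kappa)}\\&+O\!\left(\frac{\log|t|}{|t|}\right),\end{aligned}$$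 uniformly in $x\in\mathbb{R}$; that is, there are constants $C$ and $T>1$, depending only on $N,\gamma,\delta,\lambda_1$ and the $a_1^{[j]}$, such that the error is at most $C\log|t|/|t|$ for all $x\in\mathbb{R}$ and all $t$ with $\pm t\ge T$. -/

import Mathlib

open scoped ComplexConjugate Matrix

noncomputable section

namespace Hirota

/-- The phase `θ(λ) = i λ (x + (2γλ + 4δλ²) t) + ∑_{j < N} a_j (λ - λ₁)^j - iπ/4`. -/
def theta (N : ℕ) (γ δ : ℝ) (lam1 : ℂ) (a : ℕ → ℂ) (x t : ℝ) (lam : ℂ) : ℂ :=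
  Complex.I * lam * (x + (2 * γ * lam + 4 * δ * lam ^ 2) * t)
    + ∑ j ∈ Finset.range N, a j * (lam - lam1) ^ j - Complex.I * Real.pi / 4

/-- The phase at the spectral parameter, `θ₁ = θ(λ₁)`. -/
def theta1 (N : ℕ) (γ δ : ℝ) (lam1 : ℂ) (a : ℕ → ℂ) (x t : ℝ) : ℂ :=
  theta N γ δ lam1 a x t lam1

/-- The Taylor coefficients `f_l` in
`exp (2 θ(λ₁ + i ε) - 2 θ(λ₁)) = ∑_l f_l ε^l` (so `f_0 = 1`). -/
def taylorCoeff (N : ℕ) (γ δ : ℝ) (lam1 : ℂ) (a : ℕ → ℂ) (x t : ℝ) (l : ℕ) : ℂ :=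
  iteratedDeriv l
    (fun ε : ℂ => Complex.exp
      (2 * theta N γ δ lam1 a x t (lam1 + Complex.I * ε) - 2 * theta1 N γ δ lam1 a x t)) 0
    / (l.factorial : ℂ)

/-- The upper triangular Toeplitz matrix `F` with entries `e^{2θ₁} f_{j-i}` for `i ≤ j`. -/
def matF (N : ℕ) (γ δ : ℝ) (lam1 : ℂ) (a : ℕ → ℂ) (x t : ℝ) : Matrix (Fin N) (Fin N) ℂ :=
  Matrix.of fun i j =>
    if i ≤ j then
      Complex.exp (2 * theta1 N γ δ lam1 a x t)
        * taylorCoeff N γ δ lam1 a x t ((j : ℕ) - (i : ℕ))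
    else 0

/-- The constant matrix `B`; with indices starting at `0` its entries are
`(λ₁ - λ₁*)⁻¹ * binom (i+j) i * (i / (λ₁* - λ₁))^(i+j)`. -/
def matB (N : ℕ) (lam1 : ℂ) : Matrix (Fin N) (Fin N) ℂ :=
  Matrix.of fun i j =>
    1 / (lam1 - conj lam1) * (((i : ℕ) + (j : ℕ)).choose (i : ℕ) : ℂ)
      * (Complex.I / (conj lam1 - lam1)) ^ ((i : ℕ) + (j : ℕ))

/-- `M = F† B F + B`. -/
def matM (N : ℕ) (γ δ : ℝ) (lam1 : ℂ) (a : ℕ → ℂ) (x t : ℝ) : Matrix (Fin N) (Fin N) ℂ :=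
  (matF N γ δ lam1 a x t)ᴴ * matB N lam1 * matF N γ δ lam1 a x t + matB N lam1

/-- `G = [[M, F₁†], [e₁, 0]]`, where `F₁` is the first row of `F` and `e₁ = (1, 0, …, 0)`. -/
def matG (N : ℕ) [NeZero N] (γ δ : ℝ) (lam1 : ℂ) (a : ℕ → ℂ) (x t : ℝ) :
    Matrix (Fin N ⊕ Unit) (Fin N ⊕ Unit) ℂ :=
  Matrix.fromBlocks (matM N γ δ lam1 a x t)
    (Matrix.of fun i _ => conj (matF N γ δ lam1 a x t 0 i))
    (Matrix.of fun _ j => if j = 0 then 1 else 0)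
    0

/-- The `N`-th order soliton with the single spectral parameter `λ₁`. -/
def soliton (N : ℕ) [NeZero N] (γ δ : ℝ) (lam1 : ℂ) (a : ℕ → ℂ) (x t : ℝ) : ℂ :=
  2 * (matG N γ δ lam1 a x t).det / (matM N γ δ lam1 a x t).det

/-- The hyperbolic secant. -/
def sech (y : ℝ) : ℝ := 1 / Real.cosh y

/-- The velocity `v₁`. -/
def velocity (γ δ : ℝ) (lam1 : ℂ) : ℝ :=
  -4 * (lam1.re * γ - lam1.im ^ 2 * δ + 3 * lam1.re ^ 2 * δ)

/-- The constant `C₁ = 16 δ λ_I² + 8 i γ λ_I + 48 i δ λ_R λ_I`. -/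
def coeffC (γ δ : ℝ) (lam1 : ℂ) : ℂ :=
  16 * δ * lam1.im ^ 2 + 8 * Complex.I * γ * lam1.im
    + 48 * Complex.I * δ * lam1.re * lam1.im

/-- The shift `Δ^{[κ]}`, the same for left and right characteristic curves. -/
def shift (N : ℕ) (γ δ : ℝ) (lam1 : ℂ) (κ : ℕ) : ℝ :=
  Real.log (((N - κ).factorial : ℝ) / ((κ - 1).factorial : ℝ))
    - ((N : ℝ) + 1 - 2 * κ) * (Real.log (2 * lam1.im) + Real.log ‖coeffC γ δ lam1‖)

/-- The coordinate `s_l = x ∓ ((N+1-2κ)/(2λ_I)) log|t| - v₁ t`, with `σ = ±1` for `t → ±∞`. -/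
def sLeft (σ : ℝ) (N : ℕ) (γ δ : ℝ) (lam1 : ℂ) (κ : ℕ) (x t : ℝ) : ℝ :=
  x - σ * (((N : ℝ) + 1 - 2 * κ) / (2 * lam1.im)) * Real.log |t| - velocity γ δ lam1 * t

/-- The coordinate `s_r = x ± ((N+1-2κ)/(2λ_I)) log|t| - v₁ t`, with `σ = ±1` for `t → ±∞`. -/
def sRight (σ : ℝ) (N : ℕ) (γ δ : ℝ) (lam1 : ℂ) (κ : ℕ) (x t : ℝ) : ℝ :=
  x + σ * (((N : ℝ) + 1 - 2 * κ) / (2 * lam1.im)) * Real.log |t| - velocity γ δ lam1 * t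

/-- The soliton travelling along a left curve. The phase `½ arg (C₁/C₁*)` is taken on the branch
on which it equals `arg C₁`. -/
def leftSoliton (σ : ℝ) (N : ℕ) (γ δ : ℝ) (lam1 : ℂ) (a : ℕ → ℂ) (κ : ℕ) (x t : ℝ) : ℂ :=
  2 * lam1.im
    * sech (2 * lam1.im * sLeft σ N γ δ lam1 κ x t + σ * shift N γ δ lam1 κ - 2 * (a 0).re)
    * Complex.exp (Complex.I *
        (-2 * (theta1 N γ δ lam1 a x t).im
          + σ * ((N : ℝ) + 1 - 2 * κ) * (coeffC γ δ lam1).arg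
          + Real.pi * (1 / 2 + κ)))

/-- The soliton travelling along a right curve. -/
def rightSoliton (σ : ℝ) (N : ℕ) (γ δ : ℝ) (lam1 : ℂ) (a : ℕ → ℂ) (κ : ℕ) (x t : ℝ) : ℂ :=
  2 * lam1.im
    * sech (2 * lam1.im * sRight σ N γ δ lam1 κ x t - σ * shift N γ δ lam1 κ - 2 * (a 0).re)
    * Complex.exp (Complex.I *
        (-2 * (theta1 N γ δ lam1 a x t).im
          - σ * ((N : ℝ) + 1 - 2 * κ) * (coeffC γ δ lam1).arg
          + Real.pi * (N - 1 / 2 + κ)))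

/-- The sum of the `N` asymptotic solitons, with `σ = 1` for `t → +∞` and `σ = -1` for
`t → -∞`. -/
def asymptoticSum (σ : ℝ) (N : ℕ) (γ δ : ℝ) (lam1 : ℂ) (a : ℕ → ℂ) (x t : ℝ) : ℂ :=
  ∑ κ ∈ Finset.Icc 1 ((N + 1) / 2), leftSoliton σ N γ δ lam1 a κ x t
    + ∑ κ ∈ Finset.Icc 1 (N / 2), rightSoliton σ N γ δ lam1 a κ x t

end Hirota

end

/-!
Since `B` is `1 / (λ₁ - λ₁*)` times `U† U`, with `U` a Pascal matrix up to a scaling of its columns,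
conjugation by `U` turns `F` into a matrix `A = U F U⁻¹` with `M` proportional to
`U† (A† A + 1) U`. Hence `det M ≠ 0`, and the Schur complement of `M` in `G` gives
`q = -4 i Im λ₁ ⟨u, (A† A + 1)⁻¹ A† u⟩` with `u = (1, -1, 1, …)` (`soliton_eq`). Everything then
rests on the singular values of `A`: a singular value `ς` contributes `ς / (1 + ς²)`, half a
hyperbolic secant of `log ς`.

The Taylor coefficients satisfy a linear recurrence (`taylorCoeff_succ`), which shows that
`f_l ≈ (C₁* t)^l / l!` while `|x - v₁ t| = O(log |t|)` (`taylorCoeff_near`). Up to the factor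
`exp (2 θ₁)`, `A` is then `D (V + O(log |t| / |t|)) D⁻¹`, with `V` the Pascal matrix and
`D = diag (i! τ^{-i})`, `τ = -2 Im λ₁ C₁* t` (`rescaled_near`). The Pascal matrix factors as
`V = L W L` with `L` lower unipotent and `W` antidiagonal with entries `±1`
(`pascal_eq_lower_mul`). As `D L D⁻¹ = 1 + O(1 / |t|)`, the matrix `A` is antidiagonal to leading
order, with entries `σ_i` whose sizes are separated by powers of `|t|`. The remaining error at
`(i, j)` is small relative to the geometric mean of the antidiagonal entries in row `i` and in
column `j`, and this suffices for `(A† A + 1)⁻¹ A†` to be close to its antidiagonal model uniformly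
in the size of the `σ_i` (`antidiagonal_perturbation`). The model is exactly the sum of `N`
hyperbolic secants in the statement (`leadingTerm_eq_asymptoticSum_pos`,
`leadingTerm_eq_asymptoticSum_neg`).

For larger `|x - v₁ t|` both sides are negligible: `(A† A + 1)⁻¹ A†` is bounded by `A` and by `A⁻¹`,
that is by `|exp (2 θ₁)|` and by its inverse up to polynomial factors, and one of these decays
exponentially in `|x - v₁ t|`.
-/

noncomputable section

namespace Hirota

/-! ### Pascal matrices -/

/-- The upper triangular Pascal matrix, with entries `binom j i`. -/
def pascal (N : ℕ) : Matrix (Fin N) (Fin N) ℂ :=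
  Matrix.of fun i j => ((j : ℕ).choose (i : ℕ) : ℂ)

/-- The inverse of the upper triangular Pascal matrix, with entries `(-1)^(i+j) binom j i`. -/
def pascalInv (N : ℕ) : Matrix (Fin N) (Fin N) ℂ :=
  Matrix.of fun i j => (-1) ^ ((i : ℕ) + (j : ℕ)) * ((j : ℕ).choose (i : ℕ) : ℂ)

/-- The `j`-th column of the Pascal matrix holds the coefficients of `(1 + X)^j`, so the inverse
property is the binomial expansion of `X^j = ((1 + X) - 1)^j`. -/
theorem pascal_mul_pascalInv (N : ℕ) : pascal N * pascalInv N = 1 := by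
  ext i j
  have h : (Polynomial.X : Polynomial ℂ) ^ (j : ℕ) =
      ∑ k ∈ Finset.range ((j : ℕ) + 1), (1 + Polynomial.X) ^ k *
        Polynomial.C ((-1) ^ ((j : ℕ) - k) * ((j : ℕ).choose k : ℂ)) := by
    have := add_pow (1 + Polynomial.X : Polynomial ℂ) (-1) (j : ℕ)
    rw [show (1 + Polynomial.X + -1 : Polynomial ℂ) = Polynomial.X by ring] at this
    rw [this]
    refine Finset.sum_congr rfl fun k _ => ?_
    simp [mul_assoc]
  have h2 := congrArg (fun p => Polynomial.coeff p (i : ℕ)) h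
  simp only [Polynomial.finsetSum_coeff, Polynomial.coeff_mul_C,
    Polynomial.coeff_one_add_X_pow, Polynomial.coeff_X_pow] at h2
  rw [Matrix.mul_apply, Matrix.one_apply]
  simp only [pascal, pascalInv, Matrix.of_apply]
  rw [Fin.sum_univ_eq_sum_range (fun k => (k.choose (i : ℕ) : ℂ) *
    ((-1) ^ (k + (j : ℕ)) * ((j : ℕ).choose k : ℂ))) N]
  have h3 : ∑ k ∈ Finset.range N, (k.choose (i : ℕ) : ℂ) *
      ((-1) ^ (k + (j : ℕ)) * ((j : ℕ).choose k : ℂ))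
      = ∑ k ∈ Finset.range ((j : ℕ) + 1), (k.choose (i : ℕ) : ℂ) *
      ((-1) ^ (k + (j : ℕ)) * ((j : ℕ).choose k : ℂ)) := by
    symm
    apply Finset.sum_subset
    · intro k hk
      have := j.2
      simp only [Finset.mem_range] at *
      omega
    · intro k _ hk
      rw [Nat.choose_eq_zero_of_lt (n := (j : ℕ)) (k := k) (by simpa using hk)]
      simp
  rw [h3]
  have h4 : (if i = j then (1 : ℂ) else 0) = if (i : ℕ) = (j : ℕ) then 1 else 0 := by
    simp [Fin.ext_iff]
  rw [h4, h2]
  refine Finset.sum_congr rfl fun k hk => ?_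
  have hk' : k ≤ j := by simpa [Nat.lt_succ_iff] using hk
  have : ((-1 : ℂ)) ^ (k + (j : ℕ)) = (-1) ^ ((j : ℕ) - k) := by
    obtain ⟨d, hd⟩ := Nat.exists_eq_add_of_le hk'
    rw [hd, Nat.add_sub_cancel_left, show k + (k + d) = 2 * k + d by ring, pow_add, pow_mul]
    simp
  rw [this]

/-- The lower triangular Pascal matrix, with entries `binom (N-1-j) (N-1-i)`. -/
def lowerPascal (N : ℕ) : Matrix (Fin N) (Fin N) ℂ := (pascal N).submatrix Fin.rev Fin.rev

/-- The inverse of `lowerPascal`. -/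
def lowerPascalInv (N : ℕ) : Matrix (Fin N) (Fin N) ℂ :=
  (pascalInv N).submatrix Fin.rev Fin.rev

theorem lowerPascal_mul_inv (N : ℕ) : lowerPascal N * lowerPascalInv N = 1 := by
  have h := Matrix.submatrix_mul_equiv (pascal N) (pascalInv N) Fin.rev Fin.revPerm Fin.rev
  rw [pascal_mul_pascalInv] at h
  refine h.trans ?_
  ext i j
  simp [Matrix.one_apply]

/-- The antidiagonal matrix with alternating signs `(-1)^i` at `(i, N-1-i)`. -/
def signedRev (N : ℕ) : Matrix (Fin N) (Fin N) ℂ :=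
  Matrix.of fun i j => if j = i.rev then (-1) ^ (i : ℕ) else 0

/-- The Bruhat factorisation of the Pascal matrix: the image under the `(N-1)`-st symmetric power
of `[[1, 1], [0, 1]] = [[1, 0], [1, 1]] [[0, 1], [-1, 0]] [[1, 0], [1, 1]]`. -/
theorem pascal_eq_lower_mul (N : ℕ) :
    pascal N = lowerPascal N * signedRev N * lowerPascal N := by
  ext i j
  have hi := i.2
  have hj := j.2
  have h : (1 + Polynomial.X : Polynomial ℂ) ^ (j : ℕ) * Polynomial.X ^ (N - 1 - (j : ℕ)) =
      ∑ k ∈ Finset.range N, (1 + Polynomial.X) ^ (N - 1 - k) *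
        Polynomial.C ((-1) ^ k * ((N - 1 - (j : ℕ)).choose k : ℂ)) := by
    have := add_pow (-1) (1 + Polynomial.X : Polynomial ℂ) (N - 1 - (j : ℕ))
    rw [show (-1 + (1 + Polynomial.X) : Polynomial ℂ) = Polynomial.X by ring] at this
    rw [this, Finset.mul_sum]
    have h5 : Finset.range (N - 1 - (j : ℕ) + 1) ⊆ Finset.range N := by
      intro k hk
      simp only [Finset.mem_range] at *
      omega
    rw [← Finset.sum_subset h5]
    · refine Finset.sum_congr rfl fun k hk => ?_
      have hk' : k ≤ N - 1 - (j : ℕ) := by simpa [Nat.lt_succ_iff] using hk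
      rw [show N - 1 - k = (j : ℕ) + (N - 1 - (j : ℕ) - k) by omega, pow_add]
      simp only [Polynomial.C_mul, Polynomial.C_pow, Polynomial.C_neg, Polynomial.C_1,
        Polynomial.C_eq_natCast]
      ring
    · intro k _ hk
      rw [Nat.choose_eq_zero_of_lt (by simpa using hk)]
      simp
  have h2 := congrArg (fun p => Polynomial.coeff p (N - 1 - (i : ℕ))) h
  simp only [Polynomial.finsetSum_coeff, Polynomial.coeff_mul_C,
    Polynomial.coeff_one_add_X_pow, Polynomial.coeff_mul_X_pow'] at h2
  rw [Matrix.mul_apply]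
  have h6 : ∀ k : Fin N, (lowerPascal N * signedRev N) i k =
      lowerPascal N i k.rev * (-1) ^ (k.rev : ℕ) := by
    intro k
    rw [Matrix.mul_apply, Finset.sum_eq_single k.rev]
    · simp [signedRev]
    · intro l _ hl
      have : k ≠ l.rev := fun h => hl (by rw [h, Fin.rev_rev])
      simp [signedRev, this]
    · simp
  simp only [h6]
  rw [← Equiv.sum_comp Fin.revPerm]
  simp only [Fin.revPerm_apply, Fin.rev_rev]
  simp only [lowerPascal, pascal, Matrix.submatrix_apply, Matrix.of_apply, Fin.val_rev, Fin.rev_rev]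
  rw [Fin.sum_univ_eq_sum_range (fun k => ((N - (k + 1)).choose (N - ((i : ℕ) + 1)) : ℂ) *
    (-1) ^ k * ((N - ((j : ℕ) + 1)).choose k : ℂ)) N]
  rw [show N - ((i : ℕ) + 1) = N - 1 - i by omega, show N - ((j : ℕ) + 1) = N - 1 - j by omega]
  have h7 : ((j : ℕ).choose (i : ℕ) : ℂ) = if N - 1 - (j : ℕ) ≤ N - 1 - (i : ℕ) then
      ((j : ℕ).choose (N - 1 - (i : ℕ) - (N - 1 - (j : ℕ))) : ℂ) else 0 := by
    split_ifs with hc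
    · rw [show N - 1 - (i : ℕ) - (N - 1 - (j : ℕ)) = j - i by omega,
        Nat.choose_symm (by omega)]
    · rw [Nat.choose_eq_zero_of_lt (by omega)]
      simp
  rw [h7, h2]
  refine Finset.sum_congr rfl fun k _ => ?_
  rw [show N - (k + 1) = N - 1 - k by omega]
  ring

/-- The vector `(1, -1, 1, …)`, first row of the inverse Pascal matrix. -/
def altVec (N : ℕ) : Fin N → ℂ := fun i => (-1) ^ (i : ℕ)

/-- The Pascal factor of `B`, with the column scaling `(-1/(2 Im λ₁))^j`. -/
def cholB (N : ℕ) (lam1 : ℂ) : Matrix (Fin N) (Fin N) ℂ :=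
  Matrix.of fun i j => ((j : ℕ).choose (i : ℕ) : ℂ) * (-1 / (2 * lam1.im)) ^ (j : ℕ)

/-- The inverse of `cholB`. -/
def cholBInv (N : ℕ) (lam1 : ℂ) : Matrix (Fin N) (Fin N) ℂ :=
  Matrix.of fun i j => (-1 / (2 * lam1.im) : ℂ)⁻¹ ^ (i : ℕ) * pascalInv N i j

theorem cholB_mul_cholBInv (N : ℕ) (lam1 : ℂ) (h : lam1.im ≠ 0) :
    cholB N lam1 * cholBInv N lam1 = 1 := by
  rw [← pascal_mul_pascalInv]
  ext i j
  simp only [Matrix.mul_apply]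
  refine Finset.sum_congr rfl fun k _ => ?_
  have hr : (-1 / (2 * lam1.im) : ℂ) ≠ 0 := by simp [h]
  simp only [cholB, cholBInv, Matrix.of_apply, pascal]
  rw [inv_pow, mul_assoc, mul_inv_cancel_left₀ (pow_ne_zero _ hr)]

theorem cholBInv_mul_cholB (N : ℕ) (lam1 : ℂ) (h : lam1.im ≠ 0) :
    cholBInv N lam1 * cholB N lam1 = 1 :=
  mul_eq_one_comm.mp (cholB_mul_cholBInv N lam1 h)

theorem matB_eq (N : ℕ) (lam1 : ℂ) (h : lam1.im ≠ 0) :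
    matB N lam1 = (1 / (2 * Complex.I * lam1.im)) • ((cholB N lam1)ᴴ * cholB N lam1) := by
  ext i j
  have hc : lam1 - conj lam1 = 2 * Complex.I * lam1.im := by
    rw [Complex.sub_conj]; push_cast; ring
  have hc' : conj lam1 - lam1 = -(2 * Complex.I * lam1.im) := by rw [← hc]; ring
  have hI : (lam1.im : ℂ) ≠ 0 := by exact_mod_cast h
  have hr : Complex.I / (conj lam1 - lam1) = -1 / (2 * lam1.im) := by
    rw [hc']; field_simp
  rw [matB, Matrix.smul_apply, Matrix.of_apply, hr, hc, Matrix.mul_apply]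
  simp only [Matrix.conjTranspose_apply, cholB, Matrix.of_apply]
  have hconj : ∀ n : ℕ, star ((-1 / (2 * lam1.im) : ℂ) ^ n) = (-1 / (2 * lam1.im) : ℂ) ^ n := by
    intro n
    simp [Complex.conj_ofReal]
  have hv : (((i : ℕ) + (j : ℕ)).choose (i : ℕ) : ℂ) =
      ∑ k : Fin N, ((i : ℕ).choose k : ℂ) * ((j : ℕ).choose k : ℂ) := by
    rw [Fin.sum_univ_eq_sum_range (fun k => ((i : ℕ).choose k : ℂ) * ((j : ℕ).choose k : ℂ)) N]
    have h1 : ((i : ℕ) + (j : ℕ)).choose (i : ℕ) = ∑ k ∈ Finset.range ((i : ℕ) + 1),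
        (i : ℕ).choose k * (j : ℕ).choose k := by
      rw [Nat.add_choose_eq, Finset.Nat.sum_antidiagonal_eq_sum_range_succ
        (fun a b => (i : ℕ).choose a * (j : ℕ).choose b), ← Finset.sum_range_reflect]
      refine Finset.sum_congr rfl fun k hk => ?_
      have hk' : k ≤ i := by simpa [Nat.lt_succ_iff] using hk
      rw [show (i : ℕ) + 1 - 1 - k = i - k by omega, Nat.choose_symm hk',
        show (i : ℕ) - (i - k) = k by omega]
    rw [h1]
    push_cast
    apply Finset.sum_subset
    · intro k hk
      have := i.2
      simp only [Finset.mem_range] at *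
      omega
    · intro k _ hk
      rw [Nat.choose_eq_zero_of_lt (by simpa using hk)]
      simp
  rw [hv, Finset.mul_sum, Finset.sum_mul, smul_eq_mul, Finset.mul_sum]
  refine Finset.sum_congr rfl fun k _ => ?_
  rw [star_mul', hconj, pow_add]
  simp
  ring

theorem altVec_vecMul_cholB (N : ℕ) [NeZero N] (lam1 : ℂ) :
    altVec N ᵥ* cholB N lam1 = Pi.single 0 1 := by
  ext j
  have hj := j.2
  simp only [Matrix.vecMul, dotProduct, altVec, cholB, Matrix.of_apply]
  have h := Int.alternating_sum_range_choose (n := (j : ℕ))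
  have h' : ∑ m ∈ Finset.range ((j : ℕ) + 1), (-1 : ℂ) ^ m * ((j : ℕ).choose m : ℂ) =
      if (j : ℕ) = 0 then 1 else 0 := by
    have := congrArg (fun z : ℤ => (z : ℂ)) h
    push_cast at this
    exact this
  simp only [← mul_assoc]
  rw [← Finset.sum_mul, Fin.sum_univ_eq_sum_range
    (fun k => (-1 : ℂ) ^ k * ((j : ℕ).choose k : ℂ)) N]
  have h5 : Finset.range ((j : ℕ) + 1) ⊆ Finset.range N := by
    intro k hk
    simp only [Finset.mem_range] at *
    omega
  rw [← Finset.sum_subset h5, h']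
  · rw [Pi.single_apply]
    by_cases h0 : j = 0
    · simp [h0]
    · have : (j : ℕ) ≠ 0 := fun h => h0 (Fin.ext (by simpa using h))
      simp [h0]
  · intro k _ hk
    rw [Nat.choose_eq_zero_of_lt (by simpa using hk)]
    simp

/-! ### The soliton as a regularised inverse -/

/-- The matrix `F` in the basis in which `B` is a multiple of the identity. -/
def conjF (N : ℕ) (γ δ : ℝ) (lam1 : ℂ) (a : ℕ → ℂ) (x t : ℝ) : Matrix (Fin N) (Fin N) ℂ :=
  cholB N lam1 * matF N γ δ lam1 a x t * cholBInv N lam1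

theorem conjF_mul_cholB (N : ℕ) (γ δ : ℝ) (lam1 : ℂ) (h : lam1.im ≠ 0) (a : ℕ → ℂ) (x t : ℝ) :
    conjF N γ δ lam1 a x t * cholB N lam1 = cholB N lam1 * matF N γ δ lam1 a x t := by
  rw [conjF, Matrix.mul_assoc, cholBInv_mul_cholB N lam1 h, Matrix.mul_one]

theorem matM_eq (N : ℕ) (γ δ : ℝ) (lam1 : ℂ) (h : lam1.im ≠ 0) (a : ℕ → ℂ) (x t : ℝ) :
    matM N γ δ lam1 a x t = (1 / (2 * Complex.I * lam1.im)) •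
      ((cholB N lam1)ᴴ * ((conjF N γ δ lam1 a x t)ᴴ * conjF N γ δ lam1 a x t + 1)
        * cholB N lam1) := by
  have h1 : (cholB N lam1)ᴴ * ((conjF N γ δ lam1 a x t)ᴴ * conjF N γ δ lam1 a x t + 1)
        * cholB N lam1 = (conjF N γ δ lam1 a x t * cholB N lam1)ᴴ *
          (conjF N γ δ lam1 a x t * cholB N lam1) + (cholB N lam1)ᴴ * cholB N lam1 := by
    rw [Matrix.conjTranspose_mul]
    simp only [Matrix.mul_add, Matrix.add_mul, Matrix.mul_assoc, Matrix.mul_one]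
  rw [h1, conjF_mul_cholB N γ δ lam1 h, matM, matB_eq N lam1 h, Matrix.conjTranspose_mul]
  simp only [Matrix.mul_smul, Matrix.smul_mul, smul_add, Matrix.mul_assoc]

open scoped ComplexOrder in
theorem det_conjTranspose_mul_self_add_one_ne_zero {N : ℕ} (A : Matrix (Fin N) (Fin N) ℂ) :
    (Aᴴ * A + 1).det ≠ 0 := by
  have h : (Aᴴ * A + 1).PosDef :=
    Matrix.PosDef.posSemidef_add (Matrix.posSemidef_conjTranspose_mul_self A) Matrix.PosDef.one
  exact h.det_pos.ne'

theorem det_matM_ne_zero (N : ℕ) (γ δ : ℝ) (lam1 : ℂ) (h : lam1.im ≠ 0) (a : ℕ → ℂ) (x t : ℝ) :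
    (matM N γ δ lam1 a x t).det ≠ 0 := by
  have hU : (cholB N lam1).det ≠ 0 := by
    intro h0
    have := congrArg Matrix.det (cholB_mul_cholBInv N lam1 h)
    rw [Matrix.det_mul, h0] at this
    simp at this
  have hI : (lam1.im : ℂ) ≠ 0 := by exact_mod_cast h
  rw [matM_eq N γ δ lam1 h, Matrix.det_smul, Matrix.det_mul, Matrix.det_mul,
    Matrix.det_conjTranspose]
  refine mul_ne_zero (pow_ne_zero _ ?_) (mul_ne_zero (mul_ne_zero (star_ne_zero.mpr hU)
    (det_conjTranspose_mul_self_add_one_ne_zero _)) hU)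
  simp [hI]

/-- The Schur complement of `M` in `G` turns the quotient of determinants into an entry of the
solution of a linear system. In the basis in which `B` is a multiple of the identity the system
reads `(A† A + 1) x = A† b`, written here with `y = b - A x`. -/
theorem soliton_eq (N : ℕ) [NeZero N] (γ δ : ℝ) (lam1 : ℂ) (h : lam1.im ≠ 0) (a : ℕ → ℂ)
    (x t : ℝ) :
    ∃ X Y : Fin N → ℂ, X = (conjF N γ δ lam1 a x t)ᴴ *ᵥ Y ∧
      conjF N γ δ lam1 a x t *ᵥ X + Y = altVec N ∧
      soliton N γ δ lam1 a x t = -4 * Complex.I * lam1.im * (altVec N ⬝ᵥ X) := by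
  set A := conjF N γ δ lam1 a x t with hA
  set M := matM N γ δ lam1 a x t with hM
  set F := matF N γ δ lam1 a x t with hF
  set U := cholB N lam1 with hU
  have hI : (lam1.im : ℂ) ≠ 0 := by exact_mod_cast h
  have hdet : M.det ≠ 0 := det_matM_ne_zero N γ δ lam1 h a x t
  have hunit : IsUnit M.det := isUnit_iff_ne_zero.mpr hdet
  -- the first column of `F†`
  set w : Fin N → ℂ := fun i => conj (F 0 i) with hw
  set z : Fin N → ℂ := M⁻¹ *ᵥ w with hz
  have hMz : M *ᵥ z = w := by
    rw [hz, Matrix.mulVec_mulVec, Matrix.mul_nonsing_inv _ hunit, Matrix.one_mulVec]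
  have hq : soliton N γ δ lam1 a x t = -2 * z 0 := by
    let := Matrix.invertibleOfIsUnitDet M hunit
    have : (matG N γ δ lam1 a x t).det = M.det * (-z 0) := by
      rw [matG, Matrix.det_fromBlocks₁₁]
      congr 1
      rw [Matrix.det_unique, Matrix.invOf_eq_nonsing_inv, zero_sub, Matrix.neg_apply]
      congr 1
      rw [Matrix.mul_assoc, Matrix.mul_apply, Finset.sum_eq_single 0]
      · simp [hz, Matrix.mul_apply, Matrix.mulVec, dotProduct, hw, hM, hF]
      · intro b _ hb
        simp [hb]
      · simp
    rw [soliton, this, ← hM]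
    field_simp
  have hu : Uᵀ *ᵥ altVec N = Pi.single 0 1 := by
    rw [Matrix.mulVec_transpose]
    exact altVec_vecMul_cholB N lam1
  have hstar : Uᴴ = Uᵀ := by
    ext i j
    simp [hU, cholB, Complex.conj_ofReal]
  have hw2 : w = Uᴴ *ᵥ (Aᴴ *ᵥ altVec N) := by
    rw [Matrix.mulVec_mulVec, ← Matrix.conjTranspose_mul, hA, conjF_mul_cholB N γ δ lam1 h,
      Matrix.conjTranspose_mul, ← Matrix.mulVec_mulVec]
    rw [← hU, hstar, hu]
    ext i
    simp [hw, hF]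
  have hUz : (Aᴴ * A + 1) *ᵥ ((1 / (2 * Complex.I * lam1.im)) • (U *ᵥ z)) = Aᴴ *ᵥ altVec N := by
    have h1 : Uᴴ *ᵥ ((Aᴴ * A + 1) *ᵥ ((1 / (2 * Complex.I * lam1.im)) • (U *ᵥ z))) =
        Uᴴ *ᵥ (Aᴴ *ᵥ altVec N) := by
      rw [← hw2, ← hMz, hM, matM_eq N γ δ lam1 h, Matrix.smul_mulVec]
      simp only [Matrix.mulVec_smul, Matrix.mulVec_mulVec, Matrix.mul_assoc]
      rfl
    have h2 := congrArg (fun v => (cholBInv N lam1)ᴴ *ᵥ v) h1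
    rw [Matrix.mulVec_mulVec, Matrix.mulVec_mulVec (Aᴴ *ᵥ altVec N),
      ← Matrix.conjTranspose_mul, cholB_mul_cholBInv N lam1 h, Matrix.conjTranspose_one,
      Matrix.one_mulVec, Matrix.one_mulVec] at h2
    exact h2
  set X := (1 / (2 * Complex.I * lam1.im)) • (U *ᵥ z) with hX
  refine ⟨X, altVec N - A *ᵥ X, ?_, by abel, ?_⟩
  · rw [Matrix.mulVec_sub, ← hUz, Matrix.add_mulVec, Matrix.mulVec_mulVec, Matrix.one_mulVec]
    abel
  · rw [hq, hX, dotProduct_smul, Matrix.dotProduct_mulVec, hU, altVec_vecMul_cholB,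
      single_dotProduct, smul_eq_mul]
    field_simp
    ring

theorem norm_altVec (N : ℕ) (i : Fin N) : ‖altVec N i‖ = 1 := by
  simp [altVec]

/-- Pairing the two equations `x = A† y`, `A x + y = b` gives
`‖x‖² + ‖y‖² = Re ⟨b, y⟩`, which bounds `y`. -/
theorem norm_le_of_system {N : ℕ} (A : Matrix (Fin N) (Fin N) ℂ) (b X Y : Fin N → ℂ)
    (hb : ∀ i, ‖b i‖ ≤ 1) (hX : X = Aᴴ *ᵥ Y) (hY : A *ᵥ X + Y = b) (j : Fin N) :
    ‖Y j‖ ≤ N + 1 := by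
  have h1 : star X ⬝ᵥ X = star (A *ᵥ X) ⬝ᵥ Y := by
    conv_lhs => rw [hX]
    rw [Matrix.dotProduct_mulVec, ← hX, Matrix.star_mulVec]
  have h2 : star X ⬝ᵥ X + star Y ⬝ᵥ Y = star b ⬝ᵥ Y := by
    rw [h1, ← add_dotProduct, ← star_add, hY]
  have h3 : ∀ Z : Fin N → ℂ, (star Z ⬝ᵥ Z).re = ∑ i, ‖Z i‖ ^ 2 := by
    intro Z
    simp only [dotProduct, Complex.re_sum]
    refine Finset.sum_congr rfl fun i _ => ?_
    rw [Complex.sq_norm, Complex.normSq_apply]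
    simp
  have h4 : (star b ⬝ᵥ Y).re ≤ ∑ i, ‖Y i‖ := by
    simp only [dotProduct, Complex.re_sum]
    refine Finset.sum_le_sum fun i _ => (Complex.re_le_norm _).trans ?_
    rw [norm_mul]
    simpa using mul_le_mul_of_nonneg_right (hb i) (norm_nonneg (Y i))
  have h5 : ∑ i, ‖Y i‖ ^ 2 ≤ ∑ i, ‖Y i‖ := by
    have := congrArg Complex.re h2
    rw [Complex.add_re, h3, h3] at this
    have h6 : 0 ≤ ∑ i, ‖X i‖ ^ 2 := Finset.sum_nonneg fun i _ => by positivity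
    linarith
  have h7 : ∑ i, (‖Y i‖ - 1 / 2) ^ 2 ≤ (N : ℝ) / 4 := by
    have : ∀ i, (‖Y i‖ - 1 / 2) ^ 2 = ‖Y i‖ ^ 2 - ‖Y i‖ + 1 / 4 := fun i => by ring
    simp only [this, Finset.sum_add_distrib, Finset.sum_sub_distrib]
    simp
    linarith
  have h8 : (‖Y j‖ - 1 / 2) ^ 2 ≤ (N : ℝ) / 4 :=
    (Finset.single_le_sum (f := fun i => (‖Y i‖ - 1 / 2) ^ 2) (fun i _ => by positivity)
      (Finset.mem_univ j)).trans h7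
  have h9 : (0 : ℝ) ≤ N := Nat.cast_nonneg N
  nlinarith

/-! ### Perturbation of the regularised inverse -/

/-- Stability of the scalar system `X = σ* Y`, `σ X + Y = b`, uniformly in the size `s²` of `σ`,
under errors of relative size `1 + s`. -/
theorem scalar_system_bound {σ X Y b p g : ℂ} {s ε : ℝ} (hs : 0 ≤ s) (hσ : ‖σ‖ = s ^ 2)
    (hX : X = conj σ * Y + p) (hY : σ * X + Y = b + g) (hb : ‖b‖ ≤ 1)
    (hp : ‖p‖ ≤ ε * (1 + s)) (hg : ‖g‖ ≤ ε * (1 + s)) :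
    (1 + s) * ‖X - conj σ * b / (1 + (‖σ‖ : ℂ) ^ 2)‖ ≤ 4 * ε ∧
      (1 + s) * (‖X‖ + ‖Y‖) ≤ 4 + 8 * ε := by
  have hε : 0 ≤ ε := by
    have := (norm_nonneg p).trans hp
    by_contra hneg
    nlinarith
  have hd : (0 : ℝ) < 1 + s ^ 4 := by positivity
  have hn : ‖(1 + (‖σ‖ : ℂ) ^ 2)‖ = 1 + s ^ 4 := by
    rw [hσ]
    have : (1 + ((s ^ 2 : ℝ) : ℂ) ^ 2) = ((1 + s ^ 4 : ℝ) : ℂ) := by push_cast; ring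
    rw [this, Complex.norm_real, Real.norm_of_nonneg hd.le]
  have hne : (1 + (‖σ‖ : ℂ) ^ 2) ≠ 0 := by
    rw [← norm_ne_zero_iff, hn]; exact hd.ne'
  have hcs : conj σ * σ = (‖σ‖ : ℂ) ^ 2 := Complex.conj_mul' σ
  have eX : X - conj σ * b / (1 + (‖σ‖ : ℂ) ^ 2) =
      (conj σ * g + p) / (1 + (‖σ‖ : ℂ) ^ 2) := by
    field_simp
    linear_combination hX + conj σ * hY - X * hcs
  have eY : Y = (b + g - σ * p) / (1 + (‖σ‖ : ℂ) ^ 2) := by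
    rw [eq_div_iff hne]
    linear_combination hY - σ * hX - Y * hcs
  have h1 : (1 + s) ^ 2 * (1 + s ^ 2) ≤ 4 * (1 + s ^ 4) := by
    nlinarith [sq_nonneg (1 - s), sq_nonneg (1 - s ^ 2),
      mul_nonneg (sq_nonneg (1 - s)) (by positivity : 0 ≤ 1 + s ^ 2)]
  have h2 : (1 + s) * s ^ 2 ≤ 2 * (1 + s ^ 4) := by
    nlinarith [sq_nonneg (1 - s ^ 2), mul_nonneg (sq_nonneg (1 - s)) (sq_nonneg s)]
  have h3 : 1 + s ≤ 2 * (1 + s ^ 4) := by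
    nlinarith [sq_nonneg (1 - s ^ 2), sq_nonneg (1 - s)]
  have hcn : ‖conj σ‖ = s ^ 2 := by rw [RCLike.norm_conj, hσ]
  have bX : (1 + s) * ‖X - conj σ * b / (1 + (‖σ‖ : ℂ) ^ 2)‖ ≤ 4 * ε := by
    rw [eX, norm_div, hn, ← mul_div_assoc, div_le_iff₀ hd]
    have : ‖conj σ * g + p‖ ≤ (1 + s ^ 2) * (ε * (1 + s)) := by
      refine (norm_add_le _ _).trans ?_
      rw [norm_mul, hcn]
      nlinarith [mul_le_mul_of_nonneg_left hg (sq_nonneg s)]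
    calc (1 + s) * ‖conj σ * g + p‖ ≤ (1 + s) * ((1 + s ^ 2) * (ε * (1 + s))) := by gcongr
      _ = ε * ((1 + s) ^ 2 * (1 + s ^ 2)) := by ring
      _ ≤ ε * (4 * (1 + s ^ 4)) := by gcongr
      _ = _ := by ring
  refine ⟨bX, ?_⟩
  have bX0 : (1 + s) * ‖conj σ * b / (1 + (‖σ‖ : ℂ) ^ 2)‖ ≤ 2 := by
    rw [norm_div, hn, ← mul_div_assoc, div_le_iff₀ hd, norm_mul, hcn]
    calc (1 + s) * (s ^ 2 * ‖b‖) ≤ (1 + s) * (s ^ 2 * 1) := by gcongr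
      _ = (1 + s) * s ^ 2 := by ring
      _ ≤ _ := h2
  have bY : (1 + s) * ‖Y‖ ≤ 2 + 4 * ε := by
    rw [eY, norm_div, hn, ← mul_div_assoc, div_le_iff₀ hd]
    have : ‖b + g - σ * p‖ ≤ 1 + (1 + s ^ 2) * (ε * (1 + s)) := by
      refine (norm_sub_le _ _).trans ?_
      have := norm_add_le b g
      rw [norm_mul, hσ]
      nlinarith [mul_le_mul_of_nonneg_left hp (sq_nonneg s)]
    calc (1 + s) * ‖b + g - σ * p‖ ≤ (1 + s) * (1 + (1 + s ^ 2) * (ε * (1 + s))) := by gcongr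
      _ = (1 + s) + ε * ((1 + s) ^ 2 * (1 + s ^ 2)) := by ring
      _ ≤ 2 * (1 + s ^ 4) + ε * (4 * (1 + s ^ 4)) := by gcongr
      _ = _ := by ring
  have := norm_le_norm_sub_add X (conj σ * b / (1 + (‖σ‖ : ℂ) ^ 2))
  nlinarith

theorem norm_mulVec_le {N : ℕ} (H : Matrix (Fin N) (Fin N) ℂ) (v : Fin N → ℂ) (c : ℝ)
    (hH : ∀ i j, ‖H i j‖ ≤ c) (i : Fin N) : ‖(H *ᵥ v) i‖ ≤ c * ∑ j, ‖v j‖ := by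
  simp only [Matrix.mulVec, dotProduct, Finset.mul_sum]
  refine (norm_sum_le _ _).trans (Finset.sum_le_sum fun j _ => ?_)
  rw [norm_mul]
  exact mul_le_mul_of_nonneg_right (hH i j) (norm_nonneg _)

theorem norm_mul_apply_le {N : ℕ} (G H : Matrix (Fin N) (Fin N) ℂ) (c d : ℝ) (hc : 0 ≤ c)
    (hG : ∀ i j, ‖G i j‖ ≤ c) (hH : ∀ i j, ‖H i j‖ ≤ d) (i j : Fin N) :
    ‖(G * H) i j‖ ≤ N * (c * d) := by
  rw [Matrix.mul_apply]
  refine (norm_sum_le _ _).trans ?_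
  calc ∑ k, ‖G i k * H k j‖ ≤ ∑ _k : Fin N, c * d := by
        refine Finset.sum_le_sum fun k _ => ?_
        rw [norm_mul]
        exact mul_le_mul (hG i k) (hH k j) (norm_nonneg _) hc
    _ = N * (c * d) := by simp

/-- Suppose that, up to factors `1 + κ` close to the identity, `A` is antidiagonal with entries
`σ i`, and that the remaining error at `(i, j)` is small compared with the geometric mean of the
antidiagonal entries in row `i` and in column `j`. Then the solution of `x = A† y`, `A x + y = b`
is close to that of the antidiagonal system, however large or small the `σ i` are. -/
theorem antidiagonal_perturbation (N : ℕ) :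
    ∃ C η₀ : ℝ, 0 ≤ C ∧ 0 < η₀ ∧ ∀ (A K Ki R κ : Matrix (Fin N) (Fin N) ℂ) (σ b u X Y : Fin N → ℂ)
      (s : Fin N → ℝ) (η : ℝ), 0 ≤ η → η ≤ η₀ → (∀ i, 0 ≤ s i) → (∀ i, ‖σ i‖ = s i ^ 2) →
      Ki * K = 1 → Ki = 1 + κ → (∀ i j, ‖κ i j‖ ≤ η) →
      (∀ i j, (Ki * A * Ki) i j = (if j = i.rev then σ i else 0) + R i j) →
      (∀ i j, ‖R i j‖ ≤ η * (s i * s j.rev)) → (∀ i, ‖b i‖ ≤ 1) → (∀ i, ‖u i‖ ≤ 1) →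
      X = Aᴴ *ᵥ Y → A *ᵥ X + Y = b →
      ‖u ⬝ᵥ X - ∑ i, u i.rev * (conj (σ i) * b i / (1 + (‖σ i‖ : ℂ) ^ 2))‖ ≤ C * η := by
  have hN0 : (0 : ℝ) ≤ N := Nat.cast_nonneg N
  refine ⟨4 * N * (N + 2) * (8 * N + 2) + N * (8 * N + 1), 1 / (16 * N * (N + 2) + 1),
    by positivity, by positivity, ?_⟩
  intro A K Ki R κ σ b u X Y s η hη0 hη hs hσ hK hκ hκη hA hR hb hu hX hY
  have hη1 : η ≤ 1 := hη.trans (by rw [div_le_one (by positivity)]; nlinarith)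
  have hK' : K * Ki = 1 := mul_eq_one_comm.mp hK
  set X' := K *ᵥ X with hX'
  set Y' := Kᴴ *ᵥ Y with hY'
  have hXX : X = Ki *ᵥ X' := by rw [hX', Matrix.mulVec_mulVec, hK, Matrix.one_mulVec]
  have hYY : Y = Kiᴴ *ᵥ Y' := by
    rw [hY', Matrix.mulVec_mulVec, ← Matrix.conjTranspose_mul, hK', Matrix.conjTranspose_one,
      Matrix.one_mulVec]
  have e1 : (Kiᴴ * Ki) *ᵥ X' = (Ki * A * Ki)ᴴ *ᵥ Y' := by
    rw [← Matrix.mulVec_mulVec, ← hXX, Matrix.mul_assoc, Matrix.conjTranspose_mul,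
      Matrix.conjTranspose_mul, hX, hYY]
    simp only [Matrix.mulVec_mulVec, Matrix.mul_assoc]
  have e2 : (Ki * A * Ki) *ᵥ X' + (Ki * Kiᴴ) *ᵥ Y' = Ki *ᵥ b := by
    rw [← Matrix.mulVec_mulVec, ← hXX, ← Matrix.mulVec_mulVec, ← Matrix.mulVec_mulVec, ← hYY,
      ← Matrix.mulVec_add, hY]
  have e3 : Ki *ᵥ b = b + κ *ᵥ b := by rw [hκ, Matrix.add_mulVec, Matrix.one_mulVec]
  set H1 := κᴴ + κ + κᴴ * κ with hH1
  set H2 := κᴴ + κ + κ * κᴴ with hH2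
  have k1 : Kiᴴ * Ki = 1 + H1 := by
    rw [hκ, Matrix.conjTranspose_add, Matrix.conjTranspose_one, hH1]
    noncomm_ring
  have k2 : Ki * Kiᴴ = 1 + H2 := by
    rw [hκ, Matrix.conjTranspose_add, Matrix.conjTranspose_one, hH2]
    noncomm_ring
  have hκη' : ∀ i j, ‖κᴴ i j‖ ≤ η := fun i j => by simpa using hκη j i
  have bH1 : ∀ i j, ‖H1 i j‖ ≤ (N + 2) * η := by
    intro i j
    have := norm_mul_apply_le κᴴ κ η η hη0 hκη' hκη i j
    have h3 := norm_add₃_le (a := κᴴ i j) (b := κ i j) (c := (κᴴ * κ) i j)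
    rw [hH1, Matrix.add_apply, Matrix.add_apply]
    nlinarith [hκη i j, hκη' i j, mul_nonneg hN0 (mul_nonneg hη0 (sub_nonneg.mpr hη1))]
  have bH2 : ∀ i j, ‖H2 i j‖ ≤ (N + 2) * η := by
    intro i j
    have := norm_mul_apply_le κ κᴴ η η hη0 hκη hκη' i j
    have h3 := norm_add₃_le (a := κᴴ i j) (b := κ i j) (c := (κ * κᴴ) i j)
    rw [hH2, Matrix.add_apply, Matrix.add_apply]
    nlinarith [hκη i j, hκη' i j, mul_nonneg hN0 (mul_nonneg hη0 (sub_nonneg.mpr hη1))]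
  -- the weighted size of the solution
  set m := ∑ i, (1 + s i) * (‖X' i.rev‖ + ‖Y' i‖) with hm
  have hm0 : 0 ≤ m := Finset.sum_nonneg fun i _ =>
    mul_nonneg (by linarith [hs i]) (by positivity)
  have mX : ∑ i, ‖X' i‖ ≤ m := by
    rw [← Equiv.sum_comp Fin.revPerm]
    refine Finset.sum_le_sum fun i _ => ?_
    simp only [Fin.revPerm_apply]
    nlinarith [hs i, norm_nonneg (X' i.rev), norm_nonneg (Y' i)]
  have mY : ∑ i, ‖Y' i‖ ≤ m := by
    refine Finset.sum_le_sum fun i _ => ?_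
    nlinarith [hs i, norm_nonneg (X' i.rev), norm_nonneg (Y' i)]
  have msX : ∑ i, s i.rev * ‖X' i‖ ≤ m := by
    rw [← Equiv.sum_comp Fin.revPerm]
    refine Finset.sum_le_sum fun i _ => ?_
    simp only [Fin.revPerm_apply, Fin.rev_rev]
    nlinarith [hs i, norm_nonneg (X' i.rev), norm_nonneg (Y' i)]
  have msY : ∑ i, s i * ‖Y' i‖ ≤ m := by
    refine Finset.sum_le_sum fun i _ => ?_
    nlinarith [hs i, norm_nonneg (X' i.rev), norm_nonneg (Y' i)]
  set ε := (N + 2) * η * (m + 1) with hε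
  have hε0 : 0 ≤ ε := by positivity
  have main : ∀ i, (1 + s i) *
      ‖X' i.rev - conj (σ i) * b i / (1 + (‖σ i‖ : ℂ) ^ 2)‖ ≤ 4 * ε ∧
      (1 + s i) * (‖X' i.rev‖ + ‖Y' i‖) ≤ 4 + 8 * ε := by
    intro i
    have c1 := congrFun e1 i.rev
    have c2 := congrFun e2 i
    rw [k1, Matrix.add_mulVec, Matrix.one_mulVec, Pi.add_apply] at c1
    rw [k2, e3, Matrix.add_mulVec 1 H2, Matrix.one_mulVec, Pi.add_apply, Pi.add_apply,
      Pi.add_apply] at c2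
    have d1 : ((Ki * A * Ki)ᴴ *ᵥ Y') i.rev = conj (σ i) * Y' i + (Rᴴ *ᵥ Y') i.rev := by
      simp only [Matrix.mulVec, dotProduct, Matrix.conjTranspose_apply, hA, star_add, add_mul,
        Finset.sum_add_distrib]
      congr 1
      rw [Finset.sum_eq_single i]
      · simp
      · intro j _ hj
        have : ¬ i.rev = j.rev := fun h => hj (Fin.rev_injective h).symm
        simp [this]
      · simp
    have d2 : ((Ki * A * Ki) *ᵥ X') i = σ i * X' i.rev + (R *ᵥ X') i := by
      simp only [Matrix.mulVec, dotProduct, hA, add_mul, Finset.sum_add_distrib]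
      congr 1
      rw [Finset.sum_eq_single i.rev]
      · simp
      · intro j _ hj
        simp [hj]
      · simp
    have f1 : ‖(Rᴴ *ᵥ Y') i.rev‖ ≤ η * s i * m := by
      simp only [Matrix.mulVec, dotProduct, Matrix.conjTranspose_apply]
      refine (norm_sum_le _ _).trans ?_
      calc ∑ k, ‖star (R k i.rev) * Y' k‖ ≤ ∑ k, η * s i * (s k * ‖Y' k‖) := by
            refine Finset.sum_le_sum fun k _ => ?_
            rw [norm_mul, norm_star]
            have := mul_le_mul_of_nonneg_right (hR k i.rev) (norm_nonneg (Y' k))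
            rw [Fin.rev_rev] at this
            linarith
        _ = η * s i * ∑ k, (s k * ‖Y' k‖) := by rw [Finset.mul_sum]
        _ ≤ η * s i * m := mul_le_mul_of_nonneg_left msY (mul_nonneg hη0 (hs i))
    have f2 : ‖(R *ᵥ X') i‖ ≤ η * s i * m := by
      simp only [Matrix.mulVec, dotProduct]
      refine (norm_sum_le _ _).trans ?_
      calc ∑ k, ‖R i k * X' k‖ ≤ ∑ k, η * s i * (s k.rev * ‖X' k‖) := by
            refine Finset.sum_le_sum fun k _ => ?_
            rw [norm_mul]
            have := mul_le_mul_of_nonneg_right (hR i k) (norm_nonneg (X' k))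
            linarith
        _ = η * s i * ∑ k, (s k.rev * ‖X' k‖) := by rw [Finset.mul_sum]
        _ ≤ η * s i * m := mul_le_mul_of_nonneg_left msX (mul_nonneg hη0 (hs i))
    have g1 : ‖(H1 *ᵥ X') i.rev‖ ≤ (N + 2) * η * m :=
      (norm_mulVec_le H1 X' _ bH1 i.rev).trans (by gcongr)
    have g2 : ‖(H2 *ᵥ Y') i‖ ≤ (N + 2) * η * m :=
      (norm_mulVec_le H2 Y' _ bH2 i).trans (by gcongr)
    have g3 : ‖(κ *ᵥ b) i‖ ≤ η * N := by
      refine (norm_mulVec_le κ b _ hκη i).trans ?_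
      gcongr
      calc ∑ j, ‖b j‖ ≤ ∑ _j : Fin N, (1 : ℝ) := Finset.sum_le_sum fun j _ => hb j
        _ = N := by simp
    have hsi := hs i
    have p1 : 0 ≤ (N : ℝ) * η * m := by positivity
    have p2 : 0 ≤ (N : ℝ) * η * m * s i := by positivity
    have p3 : 0 ≤ η * m * s i := by positivity
    have p4 : 0 ≤ (N : ℝ) * η * s i := by positivity
    have p5 : 0 ≤ η * s i := by positivity
    refine scalar_system_bound (p := (Rᴴ *ᵥ Y') i.rev - (H1 *ᵥ X') i.rev)
      (g := (κ *ᵥ b) i - (R *ᵥ X') i - (H2 *ᵥ Y') i) (Y := Y' i) hsi (hσ i) ?_ ?_ (hb i) ?_ ?_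
    · rw [d1] at c1
      linear_combination c1
    · rw [d2] at c2
      linear_combination c2
    · refine (norm_sub_le _ _).trans ?_
      rw [hε]
      nlinarith
    · refine (norm_sub_le _ _).trans ?_
      have := norm_sub_le ((κ *ᵥ b) i) ((R *ᵥ X') i)
      rw [hε]
      nlinarith
  have hm1 : m ≤ 8 * N + 1 := by
    have h1 : m ≤ N * (4 + 8 * ε) := by
      calc m ≤ ∑ _i : Fin N, (4 + 8 * ε) := Finset.sum_le_sum fun i _ => (main i).2
        _ = N * (4 + 8 * ε) := by
          rw [Finset.sum_const, Finset.card_univ, Fintype.card_fin, nsmul_eq_mul]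
    have h2 : η * (16 * N * (N + 2) + 1) ≤ 1 := by
      rwa [le_div_iff₀ (by positivity)] at hη
    have h3 : 16 * N * ε ≤ m + 1 := by
      have : 16 * N * ε = (η * (16 * N * (N + 2))) * (m + 1) := by rw [hε]; ring
      rw [this]
      have h4 : η * (16 * N * (N + 2)) ≤ 1 := by linarith
      nlinarith
    linarith
  have hεb : ε ≤ (N + 2) * η * (8 * N + 2) := by
    rw [hε]
    have : m + 1 ≤ 8 * N + 2 := by linarith
    gcongr
  have split : u ⬝ᵥ X - ∑ i, u i.rev * (conj (σ i) * b i / (1 + (‖σ i‖ : ℂ) ^ 2)) =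
      ∑ i : Fin N, u i.rev * (X' i.rev - conj (σ i) * b i / (1 + (‖σ i‖ : ℂ) ^ 2)) +
        u ⬝ᵥ (κ *ᵥ X') := by
    rw [hXX, hκ, Matrix.add_mulVec, Matrix.one_mulVec, dotProduct_add]
    have : u ⬝ᵥ X' = ∑ i : Fin N, u i.rev * X' i.rev := by
      rw [dotProduct, ← Equiv.sum_comp Fin.revPerm]
      simp
    rw [this]
    simp only [mul_sub, Finset.sum_sub_distrib]
    ring
  rw [split]
  refine (norm_add_le _ _).trans ?_
  have t1 : ‖∑ i : Fin N, u i.rev * (X' i.rev - conj (σ i) * b i / (1 + (‖σ i‖ : ℂ) ^ 2))‖ ≤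
      N * (4 * ε) := by
    refine (norm_sum_le _ _).trans ?_
    calc _ ≤ ∑ _i : Fin N, 4 * ε := by
          refine Finset.sum_le_sum fun i _ => ?_
          rw [norm_mul]
          have h1 := (main i).1
          have h2 := hs i
          have h3 := hu i.rev
          have h4 := norm_nonneg (X' i.rev - conj (σ i) * b i / (1 + (‖σ i‖ : ℂ) ^ 2))
          nlinarith [mul_le_mul_of_nonneg_right h3 h4, mul_nonneg h2 h4]
      _ = N * (4 * ε) := by simp
  have t2 : ‖u ⬝ᵥ (κ *ᵥ X')‖ ≤ N * (η * m) := by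
    rw [dotProduct]
    refine (norm_sum_le _ _).trans ?_
    calc _ ≤ ∑ _i : Fin N, η * m := by
          refine Finset.sum_le_sum fun i _ => ?_
          rw [norm_mul]
          have h1 := (norm_mulVec_le κ X' η hκη i).trans (mul_le_mul_of_nonneg_left mX hη0)
          have h3 := hu i
          nlinarith [norm_nonneg ((κ *ᵥ X') i)]
      _ = N * (η * m) := by simp
  calc _ ≤ N * (4 * ε) + N * (η * m) := add_le_add t1 t2
    _ ≤ N * (4 * ((N + 2) * η * (8 * N + 2))) + N * (η * (8 * N + 1)) := by gcongr
    _ = _ := by ring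

/-! ### The Taylor coefficients of the phase exponential -/

theorem contDiff_polynomial_eval (Q : Polynomial ℂ) (n : WithTop ℕ∞) :
    ContDiff ℂ n (fun ε => Q.eval ε) := by
  simpa using Q.contDiff_aeval (𝕜 := ℂ) n

theorem iteratedDeriv_polynomial_eval_zero (Q : Polynomial ℂ) (k : ℕ) :
    iteratedDeriv k (fun ε => Q.eval ε) 0 = k.factorial * Q.coeff k := by
  have h : ∀ k (Q : Polynomial ℂ), iteratedDeriv k (fun ε => Q.eval ε) =
      fun ε => (Polynomial.derivative^[k] Q).eval ε := by
    intro k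
    induction k with
    | zero => intro Q; simp
    | succ k ih =>
      intro Q
      rw [iteratedDeriv_succ']
      have : deriv (fun ε => Q.eval ε) = fun ε => Q.derivative.eval ε := by
        ext ε; exact Q.deriv
      rw [this, ih, Function.iterate_succ_apply]
  rw [h]
  simp only
  rw [← Polynomial.coeff_zero_eq_eval_zero, Polynomial.coeff_iterate_derivative]
  simp [Nat.descFactorial_self]

/-- If `h' = Q h` for a polynomial `Q`, the Taylor coefficients of `h` satisfy the recurrence
obtained by comparing coefficients. -/
theorem taylor_recurrence (Q : Polynomial ℂ) (h : ℂ → ℂ) (hh : ContDiff ℂ ⊤ h)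
    (hd : ∀ ε, deriv h ε = Q.eval ε * h ε) (l : ℕ) :
    ((l : ℂ) + 1) * (iteratedDeriv (l + 1) h 0 / ((l + 1).factorial : ℂ)) =
      ∑ k ∈ Finset.range (l + 1), Q.coeff k *
        (iteratedDeriv (l - k) h 0 / ((l - k).factorial : ℂ)) := by
  have h1 : deriv h = fun ε => Q.eval ε * h ε := funext hd
  rw [iteratedDeriv_succ', h1, iteratedDeriv_fun_mul (contDiff_polynomial_eval Q _).contDiffAt
    ((hh.of_le le_top).contDiffAt), Finset.sum_div, Finset.mul_sum]
  refine Finset.sum_congr rfl fun k hk => ?_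
  have hk' : k ≤ l := by simpa [Nat.lt_succ_iff] using hk
  rw [iteratedDeriv_polynomial_eval_zero, Nat.factorial_succ]
  have h2 : ((l.choose k : ℕ) : ℂ) * (k.factorial : ℂ) * ((l - k).factorial : ℂ) =
      (l.factorial : ℂ) := by
    exact_mod_cast Nat.choose_mul_factorial_mul_factorial hk'
  have h3 : (l.factorial : ℂ) ≠ 0 := by exact_mod_cast l.factorial_ne_zero
  have h4 : ((l - k).factorial : ℂ) ≠ 0 := by exact_mod_cast (l - k).factorial_ne_zero
  have h5 : ((l : ℂ) + 1) ≠ 0 := by exact_mod_cast l.succ_ne_zero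
  push_cast
  field_simp
  rw [← h2]
  ring

/-- The polynomial in `ε` which differs from `2 θ(λ₁ + i ε)` by a constant. -/
def phasePoly (N : ℕ) (γ δ : ℝ) (lam1 : ℂ) (a : ℕ → ℂ) (x t : ℝ) : Polynomial ℂ :=
  Polynomial.C (-2 * (x + (4 * γ * lam1 + 12 * δ * lam1 ^ 2) * t)) * Polynomial.X
    + Polynomial.C (-2 * Complex.I * (2 * γ + 12 * δ * lam1) * t) * Polynomial.X ^ 2
    + Polynomial.C (8 * δ * t : ℂ) * Polynomial.X ^ 3
    + ∑ j ∈ Finset.range N, Polynomial.C (2 * a j * Complex.I ^ j) * Polynomial.X ^ j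

theorem two_theta_eq (N : ℕ) (γ δ : ℝ) (lam1 : ℂ) (a : ℕ → ℂ) (x t : ℝ) (ε : ℂ) :
    2 * theta N γ δ lam1 a x t (lam1 + Complex.I * ε) =
      2 * Complex.I * lam1 * (x + (2 * γ * lam1 + 4 * δ * lam1 ^ 2) * t)
        - Complex.I * Real.pi / 2 + (phasePoly N γ δ lam1 a x t).eval ε := by
  have hI := Complex.I_sq
  simp only [theta, phasePoly, Polynomial.eval_add, Polynomial.eval_mul, Polynomial.eval_C,
    Polynomial.eval_X, Polynomial.eval_pow, Polynomial.eval_finsetSum, add_sub_cancel_left,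
    mul_pow]
  have : ∑ j ∈ Finset.range N, 2 * a j * Complex.I ^ j * ε ^ j =
      2 * ∑ j ∈ Finset.range N, a j * (Complex.I ^ j * ε ^ j) := by
    rw [Finset.mul_sum]
    exact Finset.sum_congr rfl fun j _ => by ring
  rw [this]
  have hI3 : Complex.I ^ 3 = -Complex.I := by rw [pow_succ, hI]; ring
  have hI4 : Complex.I ^ 4 = 1 := by rw [pow_succ, hI3]; linear_combination -hI
  ring_nf
  simp only [hI, hI3, hI4]
  ring

/-- The Taylor recurrence for the coefficients `f_l`. -/
theorem taylorCoeff_succ (N : ℕ) (γ δ : ℝ) (lam1 : ℂ) (a : ℕ → ℂ) (x t : ℝ) (l : ℕ) :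
    ((l : ℂ) + 1) * taylorCoeff N γ δ lam1 a x t (l + 1) =
      ∑ k ∈ Finset.range (l + 1), (phasePoly N γ δ lam1 a x t).derivative.coeff k *
        taylorCoeff N γ δ lam1 a x t (l - k) := by
  set P := phasePoly N γ δ lam1 a x t with hP
  have h : (fun ε : ℂ => Complex.exp (2 * theta N γ δ lam1 a x t (lam1 + Complex.I * ε) -
      2 * theta1 N γ δ lam1 a x t)) = fun ε => Complex.exp (P.eval ε - P.eval 0) := by
    ext ε
    congr 1
    have h0 := two_theta_eq N γ δ lam1 a x t 0
    rw [mul_zero, add_zero] at h0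
    rw [theta1, two_theta_eq, h0]
    ring
  simp only [taylorCoeff, h]
  refine taylor_recurrence P.derivative _ (by have := contDiff_polynomial_eval P ⊤; fun_prop) (fun ε => ?_) l
  have h1 : HasDerivAt (fun ε => P.eval ε - P.eval 0) (P.derivative.eval ε) ε :=
    (P.hasDerivAt ε).sub_const _
  rw [h1.cexp.deriv, mul_comm]

theorem taylorCoeff_zero (N : ℕ) (γ δ : ℝ) (lam1 : ℂ) (a : ℕ → ℂ) (x t : ℝ) :
    taylorCoeff N γ δ lam1 a x t 0 = 1 := by
  simp [taylorCoeff, theta1]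

/-- The recurrence `(l + 1) f_{l+1} = ∑ q_k f_{l-k}` makes `f_l` close to `ω^l / l!` when `q_0` is
close to `ω` and no `q_k` is larger than `τ ~ |ω|`: the scale `τ^l` is only reached by the terms
with `k = 0`. -/
theorem recurrence_bound (B : ℕ → ℝ) (l : ℕ) :
    ∃ C : ℝ, 0 ≤ C ∧ ∀ (f q : ℕ → ℂ) (ω : ℂ) (τ η : ℝ), f 0 = 1 →
      (∀ l : ℕ, ((l : ℂ) + 1) * f (l + 1) = ∑ k ∈ Finset.range (l + 1), q k * f (l - k)) →
      1 ≤ τ → η ≤ 1 → 1 ≤ τ * η → ‖ω‖ ≤ B 0 * τ → ‖q 0 - ω‖ ≤ B 0 * (τ * η) →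
      (∀ k, ‖q (k + 1)‖ ≤ B (k + 1) * τ) → ‖f l - ω ^ l / l.factorial‖ ≤ C * (τ ^ l * η) := by
  induction l using Nat.strong_induction_on with
  | _ l ih =>
  cases l with
  | zero =>
    refine ⟨0, le_rfl, ?_⟩
    intro f q ω τ η h0 _ _ _ _ _ _ _
    simp [h0]
  | succ l =>
    choose! c hc0 hc using fun m (hm : m < l + 1) => ih m hm
    refine ⟨|B 0| * c l + |B 0| * (c l + |B 0| ^ l) +
      ∑ k ∈ Finset.range l, |B (k + 1)| * (c (l - (k + 1)) + |B 0| ^ (l - (k + 1))), ?_, ?_⟩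
    · have := hc0 l (by omega)
      refine add_nonneg (by positivity) (Finset.sum_nonneg fun k _ => ?_)
      have := hc0 (l - (k + 1)) (by omega)
      positivity
    intro f q ω τ η h0 hrec hτ hη hτη hω hq0 hq
    have hη0 : 0 ≤ η := by
      by_contra hneg
      nlinarith
    have hτ0 : 0 ≤ τ := by linarith
    have hB0 : ‖ω‖ ≤ |B 0| * τ := hω.trans (mul_le_mul_of_nonneg_right (le_abs_self _) hτ0)
    have est : ∀ m < l + 1, ‖f m - ω ^ m / m.factorial‖ ≤ c m * (τ ^ m * η) := fun m hm =>
      hc m hm f q ω τ η h0 hrec hτ hη hτη hω hq0 hq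
    have size : ∀ m < l + 1, ‖f m‖ ≤ (c m + |B 0| ^ m) * τ ^ m := by
      intro m hm
      have h1 := norm_le_norm_sub_add (f m) (ω ^ m / m.factorial)
      have h2 : ‖ω ^ m / (m.factorial : ℂ)‖ ≤ (|B 0| * τ) ^ m := by
        rw [norm_div, norm_pow, Complex.norm_natCast]
        have : (1 : ℝ) ≤ m.factorial := by exact_mod_cast m.factorial_pos
        refine (div_le_self (by positivity) this).trans ?_
        gcongr
      have h3 : c m * (τ ^ m * η) ≤ c m * τ ^ m := by
        have := hc0 m hm
        have h4 : τ ^ m * η ≤ τ ^ m * 1 := by gcongr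
        rw [mul_one] at h4
        gcongr
      rw [mul_pow] at h2
      have := est m hm
      linarith
    have hfac : (((l + 1).factorial : ℕ) : ℂ) = ((l : ℂ) + 1) * (l.factorial : ℂ) := by
      rw [Nat.factorial_succ]; push_cast; ring
    have hl1 : ((l : ℂ) + 1) ≠ 0 := by exact_mod_cast l.succ_ne_zero
    have hlf : (l.factorial : ℂ) ≠ 0 := by exact_mod_cast l.factorial_ne_zero
    have key : ((l : ℂ) + 1) * (f (l + 1) - ω ^ (l + 1) / (l + 1).factorial) =
        ω * (f l - ω ^ l / l.factorial) + (q 0 - ω) * f l +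
          ∑ k ∈ Finset.range l, q (k + 1) * f (l - (k + 1)) := by
      rw [mul_sub, hrec, Finset.sum_range_succ', hfac]
      simp only [Nat.sub_zero]
      field_simp
      ring
    have hle : ‖f (l + 1) - ω ^ (l + 1) / (l + 1).factorial‖ ≤
        ‖((l : ℂ) + 1) * (f (l + 1) - ω ^ (l + 1) / (l + 1).factorial)‖ := by
      rw [norm_mul]
      have : (1 : ℝ) ≤ ‖(l : ℂ) + 1‖ := by
        have h : ‖(l : ℂ) + 1‖ = (l : ℝ) + 1 := by
          exact_mod_cast Complex.norm_natCast (l + 1)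
        rw [h]
        linarith [(Nat.cast_nonneg l : (0 : ℝ) ≤ l)]
      exact le_mul_of_one_le_left (norm_nonneg _) this
    refine hle.trans ?_
    rw [key]
    refine (norm_add₃_le).trans ?_
    have t1 : ‖ω * (f l - ω ^ l / l.factorial)‖ ≤ |B 0| * c l * (τ ^ (l + 1) * η) := by
      rw [norm_mul]
      calc _ ≤ (|B 0| * τ) * (c l * (τ ^ l * η)) :=
            mul_le_mul hB0 (est l (by omega)) (norm_nonneg _) (by positivity)
        _ = _ := by ring
    have t2 : ‖(q 0 - ω) * f l‖ ≤ |B 0| * (c l + |B 0| ^ l) * (τ ^ (l + 1) * η) := by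
      rw [norm_mul]
      have : ‖q 0 - ω‖ ≤ |B 0| * (τ * η) :=
        hq0.trans (mul_le_mul_of_nonneg_right (le_abs_self _) (by positivity))
      calc _ ≤ (|B 0| * (τ * η)) * ((c l + |B 0| ^ l) * τ ^ l) :=
            mul_le_mul this (size l (by omega)) (norm_nonneg _) (by positivity)
        _ = _ := by ring
    have t3 : ‖∑ k ∈ Finset.range l, q (k + 1) * f (l - (k + 1))‖ ≤
        (∑ k ∈ Finset.range l, |B (k + 1)| * (c (l - (k + 1)) + |B 0| ^ (l - (k + 1)))) *
          (τ ^ (l + 1) * η) := by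
      rw [Finset.sum_mul]
      refine (norm_sum_le _ _).trans (Finset.sum_le_sum fun k hk => ?_)
      have hk' : k < l := by simpa using hk
      have hck := hc0 (l - (k + 1)) (by omega)
      rw [norm_mul]
      have h1 : ‖q (k + 1)‖ ≤ |B (k + 1)| * τ :=
        (hq k).trans (mul_le_mul_of_nonneg_right (le_abs_self _) hτ0)
      calc _ ≤ (|B (k + 1)| * τ) *
            ((c (l - (k + 1)) + |B 0| ^ (l - (k + 1))) * τ ^ (l - (k + 1))) :=
            mul_le_mul h1 (size _ (by omega)) (norm_nonneg _) (by positivity)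
        _ = |B (k + 1)| * (c (l - (k + 1)) + |B 0| ^ (l - (k + 1))) *
            τ ^ (l - (k + 1) + 1) := by ring
        _ ≤ |B (k + 1)| * (c (l - (k + 1)) + |B 0| ^ (l - (k + 1))) * (τ ^ (l + 1) * η) := by
            refine mul_le_mul_of_nonneg_left ?_ (by positivity)
            calc τ ^ (l - (k + 1) + 1) ≤ τ ^ l := pow_le_pow_right₀ hτ (by omega)
              _ = τ ^ l * 1 := (mul_one _).symm
              _ ≤ τ ^ l * (τ * η) := by gcongr
              _ = _ := by ring
    calc _ ≤ _ := add_le_add (add_le_add t1 t2) t3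
      _ = _ := by ring

/-- Sizes of the coefficients of the derivative of the phase polynomial, in terms of the
coordinate `x - v₁ t` of the moving frame. -/
theorem phasePoly_bound (N : ℕ) (γ δ : ℝ) (lam1 : ℂ) (a : ℕ → ℂ) :
    ∃ B : ℕ → ℝ, ‖coeffC γ δ lam1‖ ≤ B 0 ∧ ∀ x t : ℝ,
      (‖(phasePoly N γ δ lam1 a x t).derivative.coeff 0 - conj (coeffC γ δ lam1) * t‖ ≤
        B 0 * (1 + |x - velocity γ δ lam1 * t|)) ∧
      ∀ k, ‖(phasePoly N γ δ lam1 a x t).derivative.coeff (k + 1)‖ ≤ B (k + 1) * (1 + |t|) := by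
  have hsum : ∀ m, Polynomial.coeff (∑ j ∈ Finset.range N,
      Polynomial.C (2 * a j * Complex.I ^ j) * Polynomial.X ^ j) m =
        if m < N then 2 * a m * Complex.I ^ m else 0 := by
    intro m
    simp only [Polynomial.finsetSum_coeff, Polynomial.coeff_C_mul, Polynomial.coeff_X_pow]
    simp
  have hsumn : ∀ m, ‖(if m < N then 2 * a m * Complex.I ^ m else 0 : ℂ)‖ ≤ 2 * ‖a m‖ := by
    intro m
    split_ifs <;> simp
  refine ⟨fun k => (k + 1) * (2 + ‖coeffC γ δ lam1‖ + ‖-2 * Complex.I * (2 * γ + 12 * δ * lam1)‖ +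
    ‖(8 * δ : ℂ)‖ + 2 * ‖a (k + 1)‖), ?_, ?_⟩
  · have h1 := norm_nonneg (-2 * Complex.I * (2 * γ + 12 * δ * lam1))
    have h2 := norm_nonneg (8 * δ : ℂ)
    have h3 := norm_nonneg (a (0 + 1))
    norm_num only
    linarith
  intro x t
  have hn1 := norm_nonneg (-2 * Complex.I * (2 * γ + 12 * δ * lam1))
  have hn2 := norm_nonneg (8 * δ : ℂ)
  have hn3 := norm_nonneg (coeffC γ δ lam1)
  constructor
  · have h1 : (phasePoly N γ δ lam1 a x t).derivative.coeff 0 - conj (coeffC γ δ lam1) * t =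
        ((-2 * (x - velocity γ δ lam1 * t) : ℝ) : ℂ) +
          (if 1 < N then 2 * a 1 * Complex.I ^ 1 else 0) := by
      rw [Polynomial.coeff_derivative, phasePoly]
      simp only [Polynomial.coeff_add, hsum, Polynomial.coeff_C_mul, Polynomial.coeff_X,
        Polynomial.coeff_X_pow]
      have hl : lam1 = lam1.re + lam1.im * Complex.I := (Complex.re_add_im lam1).symm
      have h2 : (-2 * (x + (4 * γ * lam1 + 12 * δ * lam1 ^ 2) * t) : ℂ) -
          conj (coeffC γ δ lam1) * t = ((-2 * (x - velocity γ δ lam1 * t) : ℝ) : ℂ) := by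
        simp only [coeffC, velocity, map_add, map_mul, map_pow, Complex.conj_ofReal, Complex.conj_I,
          map_ofNat]
        rw [hl]
        simp only [Complex.add_re, Complex.add_im, Complex.ofReal_re, Complex.ofReal_im,
          Complex.re_ofReal_mul, Complex.im_ofReal_mul, Complex.I_re, Complex.I_im]
        push_cast
        linear_combination (-24 * δ * lam1.im ^ 2 * t : ℂ) * Complex.I_sq
      rw [← h2]
      norm_num
      ring
    rw [h1]
    refine (norm_add_le _ _).trans ?_
    rw [Complex.norm_real, norm_mul]
    have := hsumn 1
    have h3 := norm_nonneg (a 1)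
    have h4 := abs_nonneg (x - velocity γ δ lam1 * t)
    simp only [Real.norm_eq_abs, abs_neg, Nat.abs_ofNat, CharP.cast_eq_zero, zero_add, one_mul]
    nlinarith
  · intro k
    rw [Polynomial.coeff_derivative, phasePoly]
    simp only [Polynomial.coeff_add, hsum, Polynomial.coeff_C_mul, Polynomial.coeff_X,
        Polynomial.coeff_X_pow]
    rw [norm_mul]
    have hk : ‖(((k + 1 : ℕ) : ℂ) + 1)‖ = ((k + 1 : ℕ) : ℝ) + 1 := by
      exact_mod_cast Complex.norm_natCast (k + 1 + 1)
    rw [hk, mul_comm]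
    rw [mul_assoc (((k + 1 : ℕ) : ℝ) + 1)]
    refine mul_le_mul_of_nonneg_left ?_ (by positivity)
    have h4 := abs_nonneg t
    have h5 := norm_nonneg (a (k + 1 + 1))
    refine (norm_add_le _ _).trans ?_
    have hs := hsumn (k + 1 + 1)
    have t1 : ‖(-2 * (x + (4 * γ * lam1 + 12 * δ * lam1 ^ 2) * t) : ℂ) *
        (if 1 = k + 1 + 1 then 1 else 0 : ℂ) +
        (-2 * Complex.I * (2 * γ + 12 * δ * lam1) * t) * (if k + 1 + 1 = 2 then 1 else 0 : ℂ) +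
        (8 * δ * t : ℂ) * (if k + 1 + 1 = 3 then 1 else 0 : ℂ)‖ ≤
        ‖-2 * Complex.I * (2 * γ + 12 * δ * lam1)‖ * |t| + ‖(8 * δ : ℂ)‖ * |t| := by
      have h6 : ‖(t : ℂ)‖ = |t| := by rw [Complex.norm_real, Real.norm_eq_abs]
      rw [if_neg (by omega : ¬ 1 = k + 1 + 1), mul_zero, zero_add]
      refine (norm_add_le _ _).trans (add_le_add ?_ ?_)
      · rw [norm_mul, norm_mul _ (t : ℂ), h6]
        refine mul_le_of_le_one_right (by positivity) ?_
        split_ifs <;> simp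
      · rw [norm_mul, norm_mul _ (t : ℂ), h6]
        refine mul_le_of_le_one_right (by positivity) ?_
        split_ifs <;> simp
    nlinarith

/-! ### Diagonal rescaling and the region of slow growth -/

/-- Conjugation of a matrix by the diagonal matrix with entries `d`. -/
def rescale {N : ℕ} (d : Fin N → ℂ) (H : Matrix (Fin N) (Fin N) ℂ) : Matrix (Fin N) (Fin N) ℂ :=
  Matrix.of fun i j => d i * H i j * (d j)⁻¹

theorem rescale_mul {N : ℕ} {d : Fin N → ℂ} (hd : ∀ i, d i ≠ 0) (G H : Matrix (Fin N) (Fin N) ℂ) :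
    rescale d (G * H) = rescale d G * rescale d H := by
  ext i j
  simp only [rescale, Matrix.of_apply, Matrix.mul_apply, Finset.mul_sum, Finset.sum_mul]
  refine Finset.sum_congr rfl fun k _ => ?_
  have := hd k
  field_simp

theorem rescale_one {N : ℕ} {d : Fin N → ℂ} (hd : ∀ i, d i ≠ 0) :
    rescale d (1 : Matrix (Fin N) (Fin N) ℂ) = 1 := by
  ext i j
  by_cases h : i = j
  · subst h
    simp [rescale, hd i]
  · simp [rescale, h]

theorem rescale_rescale_inv {N : ℕ} {d : Fin N → ℂ} (hd : ∀ i, d i ≠ 0)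
    (H : Matrix (Fin N) (Fin N) ℂ) : rescale d (rescale d⁻¹ H) = H := by
  ext i j
  have h1 := hd i
  have h2 := hd j
  simp only [rescale, Matrix.of_apply, Pi.inv_apply, inv_inv]
  field_simp

/-- The scaling `i! τ^{-i}`, under which the Pascal matrix becomes the Toeplitz matrix
`(τ^(j-i) / (j-i)!)`. -/
def scaleD (N : ℕ) (τ : ℂ) : Fin N → ℂ := fun i => ((i : ℕ).factorial : ℂ) / τ ^ (i : ℕ)

theorem scaleD_ne_zero (N : ℕ) {τ : ℂ} (hτ : τ ≠ 0) (i : Fin N) : scaleD N τ i ≠ 0 :=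
  div_ne_zero (by exact_mod_cast (i : ℕ).factorial_ne_zero) (pow_ne_zero _ hτ)

theorem norm_scaleD (N : ℕ) (τ : ℂ) (i : Fin N) :
    ‖scaleD N τ i‖ = ((i : ℕ).factorial : ℝ) / ‖τ‖ ^ (i : ℕ) := by
  rw [scaleD, norm_div, norm_pow, Complex.norm_natCast]

theorem norm_scaleD_div_le {N : ℕ} {τ : ℂ} (hτ : 1 ≤ ‖τ‖) {i j : Fin N} (h : i < j) :
    ‖scaleD N τ j‖ * ‖scaleD N τ i‖⁻¹ ≤ N.factorial / ‖τ‖ := by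
  have hi : (1 : ℝ) ≤ (i : ℕ).factorial := by exact_mod_cast (i : ℕ).factorial_pos
  have hj : ((j : ℕ).factorial : ℝ) ≤ N.factorial := by
    exact_mod_cast Nat.factorial_le j.2.le
  have hτ0 : 0 < ‖τ‖ := by linarith
  have hp : ‖τ‖ ^ (i : ℕ) * ‖τ‖ ≤ ‖τ‖ ^ (j : ℕ) := by
    rw [← pow_succ]
    exact pow_le_pow_right₀ hτ h
  rw [norm_scaleD, norm_scaleD, inv_div, div_mul_div_comm, div_le_div_iff₀ (by positivity) hτ0]
  calc ((j : ℕ).factorial : ℝ) * ‖τ‖ ^ (i : ℕ) * ‖τ‖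
      = ((j : ℕ).factorial : ℝ) * (‖τ‖ ^ (i : ℕ) * ‖τ‖) := by ring
    _ ≤ N.factorial * (‖τ‖ ^ (j : ℕ) * (i : ℕ).factorial) := by
        refine mul_le_mul hj (hp.trans ?_) (by positivity) (by positivity)
        exact le_mul_of_one_le_right (by positivity) hi

theorem exists_entry_bound {N : ℕ} (H : Matrix (Fin N) (Fin N) ℂ) :
    ∃ m : ℝ, 0 ≤ m ∧ ∀ i j, ‖H i j‖ ≤ m := by
  refine ⟨∑ i, ∑ j, ‖H i j‖, by positivity, fun i j => ?_⟩
  refine (Finset.single_le_sum (f := fun j => ‖H i j‖) (fun _ _ => norm_nonneg _)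
    (Finset.mem_univ j)).trans ?_
  exact Finset.single_le_sum (f := fun i => ∑ j, ‖H i j‖)
    (fun _ _ => Finset.sum_nonneg fun _ _ => norm_nonneg _) (Finset.mem_univ i)

/-- Rescaling pushes an upper triangular matrix to its diagonal. -/
theorem rescale_upper {N : ℕ} {H : Matrix (Fin N) (Fin N) ℂ} {m : ℝ} (hm : 0 ≤ m)
    (hH : ∀ i j, ‖H i j‖ ≤ m) (hup : ∀ i j, j < i → H i j = 0) {τ : ℂ} (hτ : 1 ≤ ‖τ‖)
    (i j : Fin N) :
    ‖(rescale (scaleD N τ)⁻¹ H - Matrix.diagonal fun i => H i i) i j‖ ≤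
      m * N.factorial / ‖τ‖ := by
  have hτ0 : τ ≠ 0 := by rw [← norm_pos_iff]; linarith
  rcases lt_trichotomy i j with h | h | h
  · rw [Matrix.sub_apply, Matrix.diagonal_apply_ne _ h.ne, sub_zero, rescale, Matrix.of_apply,
      Pi.inv_apply, Pi.inv_apply, inv_inv, norm_mul, norm_mul, norm_inv]
    have := norm_scaleD_div_le hτ h
    calc ‖scaleD N τ i‖⁻¹ * ‖H i j‖ * ‖scaleD N τ j‖
        = ‖H i j‖ * (‖scaleD N τ j‖ * ‖scaleD N τ i‖⁻¹) := by ring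
      _ ≤ m * (N.factorial / ‖τ‖) := mul_le_mul (hH i j) this (by positivity) hm
      _ = _ := by ring
  · subst h
    have h1 := scaleD_ne_zero N hτ0 i
    rw [Matrix.sub_apply, Matrix.diagonal_apply_eq, rescale, Matrix.of_apply, Pi.inv_apply, inv_inv]
    have : (scaleD N τ i)⁻¹ * H i i * scaleD N τ i - H i i = 0 := by field_simp; ring
    rw [this, norm_zero]
    positivity
  · rw [Matrix.sub_apply, Matrix.diagonal_apply_ne _ h.ne', rescale, Matrix.of_apply, hup i j h]
    simp only [mul_zero, zero_mul, sub_zero, norm_zero]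
    positivity

/-- Rescaling in the opposite direction pushes a lower triangular matrix to its diagonal. -/
theorem rescale_lower {N : ℕ} {H : Matrix (Fin N) (Fin N) ℂ} {m : ℝ} (hm : 0 ≤ m)
    (hH : ∀ i j, ‖H i j‖ ≤ m) (hlow : ∀ i j, i < j → H i j = 0) {τ : ℂ} (hτ : 1 ≤ ‖τ‖)
    (i j : Fin N) :
    ‖(rescale (scaleD N τ) H - Matrix.diagonal fun i => H i i) i j‖ ≤ m * N.factorial / ‖τ‖ := by
  have h := rescale_upper (H := Hᵀ) hm (fun i j => hH j i) (fun i j h => hlow j i h) hτ j i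
  convert h using 2
  simp only [Matrix.sub_apply, rescale, Matrix.of_apply, Matrix.transpose_apply, Pi.inv_apply,
    inv_inv, Matrix.diagonal_apply]
  by_cases hij : i = j
  · subst hij; simp; ring
  · simp [hij, Ne.symm hij]; ring

/-- The perturbation of a product of three matrices. -/
theorem triple_product_bound {N : ℕ} {A B C A₀ B₀ C₀ : Matrix (Fin N) (Fin N) ℂ} {m η : ℝ}
    (hm : 0 ≤ m) (hη : 0 ≤ η) (hη1 : η ≤ 1)
    (hA₀ : ∀ i j, ‖A₀ i j‖ ≤ m) (hB₀ : ∀ i j, ‖B₀ i j‖ ≤ m) (hC₀ : ∀ i j, ‖C₀ i j‖ ≤ m)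
    (hA : ∀ i j, ‖(A - A₀) i j‖ ≤ m * η) (hB : ∀ i j, ‖(B - B₀) i j‖ ≤ m * η)
    (hC : ∀ i j, ‖(C - C₀) i j‖ ≤ m * η) (i j : Fin N) :
    ‖(A * B * C - A₀ * B₀ * C₀) i j‖ ≤ 7 * N ^ 2 * m ^ 3 * η := by
  have hmη : m * η ≤ m := mul_le_of_le_one_right hm hη1
  have size : ∀ {G G₀ : Matrix (Fin N) (Fin N) ℂ}, (∀ i j, ‖G₀ i j‖ ≤ m) →
      (∀ i j, ‖(G - G₀) i j‖ ≤ m * η) → ∀ i j, ‖G i j‖ ≤ 2 * m := by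
    intro G G₀ h0 h i j
    have := norm_le_norm_sub_add (G i j) (G₀ i j)
    have h1 := h i j
    rw [Matrix.sub_apply] at h1
    linarith [h0 i j]
  have e : A * B * C - A₀ * B₀ * C₀ =
      (A - A₀) * (B * C) + A₀ * ((B - B₀) * C) + A₀ * (B₀ * (C - C₀)) := by noncomm_ring
  rw [e, Matrix.add_apply, Matrix.add_apply]
  refine norm_add₃_le.trans ?_
  have h2m : 0 ≤ 2 * m := by positivity
  have hmη0 : 0 ≤ m * η := by positivity
  have t1 := norm_mul_apply_le (A - A₀) (B * C) _ _ hmη0 hA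
    (norm_mul_apply_le B C _ _ h2m (size hB₀ hB) (size hC₀ hC)) i j
  have t2 := norm_mul_apply_le A₀ ((B - B₀) * C) _ _ hm hA₀
    (norm_mul_apply_le (B - B₀) C _ _ hmη0 hB (size hC₀ hC)) i j
  have t3 := norm_mul_apply_le A₀ (B₀ * (C - C₀)) _ _ hm hA₀
    (norm_mul_apply_le B₀ (C - C₀) _ _ hm hB₀ hC) i j
  calc _ ≤ _ := add_le_add (add_le_add t1 t2) t3
    _ = _ := by ring

/-- The unipotent Toeplitz matrix of the Taylor coefficients. -/
def matT (N : ℕ) (γ δ : ℝ) (lam1 : ℂ) (a : ℕ → ℂ) (x t : ℝ) : Matrix (Fin N) (Fin N) ℂ :=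
  Matrix.of fun i j =>
    if i ≤ j then taylorCoeff N γ δ lam1 a x t ((j : ℕ) - (i : ℕ)) else 0

theorem conjF_eq_smul (N : ℕ) (γ δ : ℝ) (lam1 : ℂ) (a : ℕ → ℂ) (x t : ℝ) :
    conjF N γ δ lam1 a x t = Complex.exp (2 * theta1 N γ δ lam1 a x t) •
      (cholB N lam1 * matT N γ δ lam1 a x t * cholBInv N lam1) := by
  have : matF N γ δ lam1 a x t = Complex.exp (2 * theta1 N γ δ lam1 a x t) •
      matT N γ δ lam1 a x t := by
    ext i j
    simp [matF, matT]
  rw [conjF, this, Matrix.mul_smul, Matrix.smul_mul]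

/-- The large parameter `τ = -2 Im λ₁ C₁* t`. -/
def tauParam (γ δ : ℝ) (lam1 : ℂ) (t : ℝ) : ℂ :=
  -2 * lam1.im * conj (coeffC γ δ lam1) * t

theorem norm_tauParam (γ δ : ℝ) {lam1 : ℂ} (h : 0 < lam1.im) (t : ℝ) :
    ‖tauParam γ δ lam1 t‖ = 2 * lam1.im * ‖coeffC γ δ lam1‖ * |t| := by
  simp [tauParam, abs_of_pos h]

theorem coeffC_ne_zero {γ δ : ℝ} (hγδ : γ ≠ 0 ∨ δ ≠ 0) {lam1 : ℂ} (h : 0 < lam1.im) :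
    coeffC γ δ lam1 ≠ 0 := by
  intro h0
  have hre := congrArg Complex.re h0
  have him := congrArg Complex.im h0
  simp [coeffC, pow_two] at hre him
  have hδ : δ = 0 := by
    rcases hre with hre | hre
    · exact hre
    · exact absurd hre h.ne'
  subst hδ
  simp at him
  rcases hγδ with h1 | h1
  · exact him.elim h1 h.ne'
  · exact h1 rfl

/-- Where `|x - v₁ t| = O(log |t|)`, the Taylor coefficients are `ω^l / l!` with `ω = C₁* t`, up to
a relative error `O(log |t| / |t|)`. -/
theorem taylorCoeff_near (N : ℕ) (γ δ : ℝ) (lam1 : ℂ) (a : ℕ → ℂ) (K : ℝ) (hK : 0 ≤ K) :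
    ∃ C : ℕ → ℝ, (∀ l, 0 ≤ C l) ∧ ∀ x t : ℝ, 1 ≤ |t| → 1 ≤ Real.log |t| →
      |x - velocity γ δ lam1 * t| ≤ K * Real.log |t| → ∀ l,
      ‖taylorCoeff N γ δ lam1 a x t l - (conj (coeffC γ δ lam1) * t) ^ l / l.factorial‖ ≤
        C l * (|t| ^ l * (Real.log |t| / |t|)) := by
  obtain ⟨B, hB0, hB⟩ := phasePoly_bound N γ δ lam1 a
  choose C hC0 hC using recurrence_bound
    (fun k => |B k| * (2 + K))
  refine ⟨C, hC0, ?_⟩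
  intro x t ht hlog hx l
  have ht0 : 0 < |t| := by linarith
  have hη : Real.log |t| / |t| ≤ 1 := by
    rw [div_le_one ht0]
    exact (Real.log_le_self ht0.le)
  have htη : |t| * (Real.log |t| / |t|) = Real.log |t| := by field_simp
  refine hC l (taylorCoeff N γ δ lam1 a x t)
    (fun k => (phasePoly N γ δ lam1 a x t).derivative.coeff k) _ |t| _
    (taylorCoeff_zero ..) (taylorCoeff_succ N γ δ lam1 a x t) ht hη (by rw [htη]; exact hlog)
    ?_ ?_ ?_
  · rw [norm_mul, RCLike.norm_conj, Complex.norm_real, Real.norm_eq_abs]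
    have h1 : ‖coeffC γ δ lam1‖ ≤ |B 0| := hB0.trans (le_abs_self _)
    refine mul_le_mul_of_nonneg_right (h1.trans ?_) ht0.le
    exact le_mul_of_one_le_right (abs_nonneg _) (by linarith)
  · rw [htη]
    refine (hB x t).1.trans ?_
    rw [mul_assoc]
    refine mul_le_mul (le_abs_self _) ?_ (by positivity) (abs_nonneg _)
    nlinarith
  · intro k
    refine ((hB x t).2 k).trans ?_
    rw [mul_assoc]
    refine mul_le_mul (le_abs_self _) ?_ (by positivity) (abs_nonneg _)
    nlinarith

/-- Where `|x - v₁ t| = O(log |t|)`, the matrix `conjF`, stripped of the factor `exp (2 θ₁)` and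
rescaled, converges to the Pascal matrix. The two triangular factors around the Toeplitz matrix
survive only through their diagonals, which turn `ω = C₁* t` into `τ = -2 Im λ₁ ω`. -/
theorem rescaled_near (N : ℕ) {γ δ : ℝ} {lam1 : ℂ} (hlam : 0 < lam1.im)
    (hC : coeffC γ δ lam1 ≠ 0) (a : ℕ → ℂ) (K : ℝ) (hK : 0 ≤ K) :
    ∃ M : ℝ, 0 ≤ M ∧ ∀ x t : ℝ, 1 ≤ |t| → 1 ≤ Real.log |t| → 1 ≤ ‖tauParam γ δ lam1 t‖ →
      |x - velocity γ δ lam1 * t| ≤ K * Real.log |t| → ∀ i j,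
      ‖(rescale (scaleD N (tauParam γ δ lam1 t))⁻¹
          (cholB N lam1 * matT N γ δ lam1 a x t * cholBInv N lam1) - pascal N) i j‖ ≤
        M * (Real.log |t| / |t|) := by
  obtain ⟨c, hc0, hc⟩ := taylorCoeff_near N γ δ lam1 a K hK
  obtain ⟨mU, hmU0, hmU⟩ := exists_entry_bound (cholB N lam1)
  obtain ⟨mV, hmV0, hmV⟩ := exists_entry_bound (cholBInv N lam1)
  set r : ℂ := -1 / (2 * lam1.im) with hr
  have hI : (lam1.im : ℂ) ≠ 0 := by exact_mod_cast hlam.ne'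
  have hr0 : r ≠ 0 := by
    rw [hr]
    exact div_ne_zero (by norm_num) (mul_ne_zero two_ne_zero hI)
  -- the limit of the rescaled Toeplitz matrix
  set T₀ : Matrix (Fin N) (Fin N) ℂ :=
    Matrix.of fun i j => (r ^ (i : ℕ))⁻¹ * pascal N i j * r ^ (j : ℕ) with hT₀
  obtain ⟨mT, hmT0, hmT⟩ := exists_entry_bound T₀
  set b : ℝ := 2 * lam1.im * ‖coeffC γ δ lam1‖ with hb
  have hb0 : 0 < b := by
    have := norm_pos_iff.mpr hC
    positivity
  set m : ℝ := mU + mV + mT + mU * N.factorial / b + mV * N.factorial / b +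
    N.factorial * ∑ l ∈ Finset.range N, c l / b ^ l with hm
  have hsum0 : 0 ≤ ∑ l ∈ Finset.range N, c l / b ^ l :=
    Finset.sum_nonneg fun l _ => div_nonneg (hc0 l) (by positivity)
  have hp1 : 0 ≤ mU * N.factorial / b := by positivity
  have hp2 : 0 ≤ mV * N.factorial / b := by positivity
  have hp3 : 0 ≤ N.factorial * ∑ l ∈ Finset.range N, c l / b ^ l := by positivity
  have hm0 : 0 ≤ m := by rw [hm]; positivity
  refine ⟨7 * N ^ 2 * m ^ 3, by positivity, ?_⟩
  intro x t ht hlog hτ hx i j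
  set τ := tauParam γ δ lam1 t with hτdef
  set η := Real.log |t| / |t| with hη
  have ht0 : 0 < |t| := by linarith
  have hη0 : 0 ≤ η := by positivity
  have hη1 : η ≤ 1 := by
    rw [hη, div_le_one ht0]
    exact Real.log_le_self ht0.le
  have hτn : ‖τ‖ = b * |t| := by rw [hτdef, norm_tauParam γ δ hlam]
  have hτ0 : τ ≠ 0 := by rw [← norm_pos_iff]; linarith
  have hinv : ∀ q : ℝ, 0 ≤ q → q * N.factorial / ‖τ‖ ≤ q * N.factorial / b * η := by
    intro q hq
    rw [hτn, hη, div_mul_div_comm]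
    exact div_le_div_of_nonneg_right (le_mul_of_one_le_right (by positivity) hlog) (by positivity)
  have hd : ∀ i, (scaleD N τ)⁻¹ i ≠ 0 := fun i => inv_ne_zero (scaleD_ne_zero N hτ0 i)
  have eU : ∀ i j, ‖(rescale (scaleD N τ)⁻¹ (cholB N lam1) -
      Matrix.diagonal fun i => cholB N lam1 i i) i j‖ ≤ m * η := by
    intro i j
    refine (rescale_upper hmU0 hmU ?_ hτ i j).trans ((hinv _ hmU0).trans ?_)
    · intro i j h
      simp [cholB, Nat.choose_eq_zero_of_lt h]
    · refine mul_le_mul_of_nonneg_right ?_ hη0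
      rw [hm]; linarith
  have eV : ∀ i j, ‖(rescale (scaleD N τ)⁻¹ (cholBInv N lam1) -
      Matrix.diagonal fun i => cholBInv N lam1 i i) i j‖ ≤ m * η := by
    intro i j
    refine (rescale_upper hmV0 hmV ?_ hτ i j).trans ((hinv _ hmV0).trans ?_)
    · intro i j h
      simp [cholBInv, pascalInv, Nat.choose_eq_zero_of_lt h]
    · refine mul_le_mul_of_nonneg_right ?_ hη0
      rw [hm]; linarith
  have eT : ∀ i j, ‖(rescale (scaleD N τ)⁻¹ (matT N γ δ lam1 a x t) - T₀) i j‖ ≤ m * η := by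
    intro i j
    by_cases hij : i ≤ j
    · obtain ⟨l, hl⟩ := Nat.exists_eq_add_of_le (Fin.le_def.mp hij)
      set w : ℂ := conj (coeffC γ δ lam1) * t with hw
      have hτr : τ = w / r := by
        rw [hτdef, tauParam, hw, hr]
        field_simp
      have e : (rescale (scaleD N τ)⁻¹ (matT N γ δ lam1 a x t) - T₀) i j =
          (taylorCoeff N γ δ lam1 a x t l - w ^ l / l.factorial) *
            (((j : ℕ).factorial : ℂ) / ((i : ℕ).factorial : ℂ) / τ ^ l) := by
        have hil : ((i : ℕ).factorial : ℂ) ≠ 0 := by exact_mod_cast (i : ℕ).factorial_ne_zero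
        have hll : (l.factorial : ℂ) ≠ 0 := by exact_mod_cast l.factorial_ne_zero
        have hch : ((j : ℕ).choose (i : ℕ) : ℂ) * (i : ℕ).factorial * l.factorial =
            (j : ℕ).factorial := by
          have := Nat.choose_mul_factorial_mul_factorial (Fin.le_def.mp hij)
          rw [show (j : ℕ) - i = l by omega] at this
          exact_mod_cast this
        have hw0 : w ≠ 0 := by
          intro h0
          rw [h0, zero_div] at hτr
          exact hτ0 hτr
        rw [Matrix.sub_apply, hT₀, rescale, Matrix.of_apply, Matrix.of_apply, matT, Matrix.of_apply,
          if_pos hij, show (j : ℕ) - i = l by omega, Pi.inv_apply, Pi.inv_apply, inv_inv, scaleD,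
          scaleD, pascal, Matrix.of_apply, sub_mul, hτr]
        congr 1
        · simp only [hl, pow_add]
          field_simp
        · rw [← hch]
          simp only [hl, pow_add, div_pow]
          field_simp
      rw [e, norm_mul, norm_div, norm_div, Complex.norm_natCast, Complex.norm_natCast, norm_pow,
        hτn]
      have h1 := hc x t ht hlog hx l
      have hjN : ((j : ℕ).factorial : ℝ) ≤ N.factorial := by
        exact_mod_cast Nat.factorial_le j.2.le
      have hi1 : (1 : ℝ) ≤ (i : ℕ).factorial := by exact_mod_cast (i : ℕ).factorial_pos
      have h2 : ((j : ℕ).factorial : ℝ) / (i : ℕ).factorial ≤ N.factorial :=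
        (div_le_self (by positivity) hi1).trans hjN
      have hlN : l ∈ Finset.range N := by
        have := j.2
        simp only [Finset.mem_range]
        omega
      have h3 : c l / b ^ l ≤ ∑ l ∈ Finset.range N, c l / b ^ l :=
        Finset.single_le_sum (f := fun l => c l / b ^ l)
          (fun l _ => div_nonneg (hc0 l) (by positivity)) hlN
      calc _ ≤ c l * (|t| ^ l * η) * (N.factorial / (b * |t|) ^ l) := by
            refine mul_le_mul h1 ?_ (by positivity)
              (mul_nonneg (hc0 l) (by positivity))
            gcongr
        _ = N.factorial * (c l / b ^ l) * η := by
            rw [mul_pow]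
            field_simp
        _ ≤ m * η := by
            refine mul_le_mul_of_nonneg_right ?_ hη0
            have : N.factorial * (c l / b ^ l) ≤
              N.factorial * ∑ l ∈ Finset.range N, c l / b ^ l := by gcongr
            rw [hm]
            linarith
    · have h1 : pascal N i j = 0 := by
        simp [pascal, Nat.choose_eq_zero_of_lt (Fin.lt_def.mp (not_le.mp hij))]
      rw [Matrix.sub_apply, hT₀, rescale, Matrix.of_apply, Matrix.of_apply, matT, Matrix.of_apply,
        if_neg hij, h1]
      simp only [mul_zero, zero_mul, sub_zero, norm_zero]
      positivity
  have hlim : pascal N = (Matrix.diagonal fun i => cholB N lam1 i i) * T₀ *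
      (Matrix.diagonal fun i => cholBInv N lam1 i i) := by
    ext i j
    rw [Matrix.mul_diagonal, Matrix.diagonal_mul, hT₀, Matrix.of_apply]
    simp only [cholB, cholBInv, pascalInv, Matrix.of_apply, Nat.choose_self, ← hr, ← two_mul,
      pow_mul, inv_pow]
    norm_num
    have hri : r ^ (i : ℕ) ≠ 0 := pow_ne_zero _ hr0
    have hrj : r ^ (j : ℕ) ≠ 0 := pow_ne_zero _ hr0
    field_simp
  rw [rescale_mul hd, rescale_mul hd, hlim]
  refine triple_product_bound hm0 hη0 hη1 ?_ ?_ ?_ eU eT eV i j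
  · intro i j
    rw [Matrix.diagonal_apply]
    split_ifs
    · exact (hmU i i).trans (by rw [hm]; linarith)
    · simpa using hm0
  · intro i j
    exact (hmT i j).trans (by rw [hm]; linarith)
  · intro i j
    rw [Matrix.diagonal_apply]
    split_ifs
    · exact (hmV i i).trans (by rw [hm]; linarith)
    · simpa using hm0

theorem exists_large_time (b q η₀ : ℝ) (hb : 0 < b) (hη : 0 < η₀) :
    ∃ T : ℝ, ∀ y ≥ T, 1 ≤ y ∧ 1 ≤ Real.log y ∧ 1 ≤ b * y ∧ q * (Real.log y / y) ≤ η₀ := by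
  have h1 : ∀ᶠ y : ℝ in Filter.atTop, 1 ≤ y := Filter.eventually_ge_atTop 1
  have h2 : ∀ᶠ y : ℝ in Filter.atTop, 1 ≤ Real.log y :=
    Real.tendsto_log_atTop.eventually_ge_atTop 1
  have h3 : ∀ᶠ y : ℝ in Filter.atTop, 1 ≤ b * y :=
    (Filter.tendsto_id.const_mul_atTop hb).eventually_ge_atTop 1
  have h4 : Filter.Tendsto (fun y : ℝ => q * (Real.log y / y)) Filter.atTop (nhds (q * 0)) :=
    (Real.isLittleO_log_id_atTop.tendsto_div_nhds_zero).const_mul q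
  rw [mul_zero] at h4
  have h5 : ∀ᶠ y : ℝ in Filter.atTop, q * (Real.log y / y) ≤ η₀ :=
    (h4.eventually (gt_mem_nhds hη)).mono fun _ h => le_of_lt h
  obtain ⟨T, hT⟩ := Filter.eventually_atTop.mp (h1.and (h2.and (h3.and h5)))
  exact ⟨T, hT⟩

/-- The antidiagonal entries `σ_i`: up to small relative errors, the singular values of `conjF`
are `|σ_i|`, and the soliton with index `i` sits where `|σ_i| = 1`. -/
def antidiag (N : ℕ) (γ δ : ℝ) (lam1 : ℂ) (a : ℕ → ℂ) (x t : ℝ) (i : Fin N) : ℂ :=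
  Complex.exp (2 * theta1 N γ δ lam1 a x t) * (-1) ^ (i : ℕ) *
    (scaleD N (tauParam γ δ lam1 t) i * (scaleD N (tauParam γ δ lam1 t) i.rev)⁻¹)

/-- The leading term of the soliton, obtained by keeping only the antidiagonal entries. -/
def leadingTerm (N : ℕ) (γ δ : ℝ) (lam1 : ℂ) (a : ℕ → ℂ) (x t : ℝ) : ℂ :=
  -4 * Complex.I * lam1.im * ∑ i : Fin N, altVec N i.rev *
    (conj (antidiag N γ δ lam1 a x t i) * altVec N i /
      (1 + (‖antidiag N γ δ lam1 a x t i‖ : ℂ) ^ 2))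

theorem norm_scaleD_mul_rev_le {N : ℕ} {τ : ℂ} (hτ : τ ≠ 0) (i j : Fin N) :
    ‖scaleD N τ i‖ * ‖scaleD N τ i.rev‖ ≤
      (N.factorial : ℝ) ^ 2 * (‖scaleD N τ j‖ * ‖scaleD N τ j.rev‖) := by
  have hτ0 : 0 < ‖τ‖ := norm_pos_iff.mpr hτ
  have e : ∀ i : Fin N, ‖scaleD N τ i‖ * ‖scaleD N τ i.rev‖ =
      (((i : ℕ).factorial : ℝ) * ((i.rev : ℕ).factorial : ℝ)) / ‖τ‖ ^ (N - 1) := by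
    intro i
    have hi := i.2
    rw [norm_scaleD, norm_scaleD, div_mul_div_comm, ← pow_add, Fin.val_rev,
      show (i : ℕ) + (N - (i + 1)) = N - 1 by omega]
  have up : ∀ i : Fin N, ((i : ℕ).factorial : ℝ) ≤ N.factorial := fun i => by
    exact_mod_cast Nat.factorial_le i.2.le
  have low : ∀ i : Fin N, (1 : ℝ) ≤ (i : ℕ).factorial := fun i => by
    exact_mod_cast (i : ℕ).factorial_pos
  rw [e, e, ← mul_div_assoc]
  refine div_le_div_of_nonneg_right ?_ (by positivity)
  calc ((i : ℕ).factorial : ℝ) * ((i.rev : ℕ).factorial : ℝ) ≤ N.factorial * N.factorial :=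
        mul_le_mul (up i) (up i.rev) (by positivity) (by positivity)
    _ = (N.factorial : ℝ) ^ 2 * (1 * 1) := by ring
    _ ≤ _ := mul_le_mul_of_nonneg_left
        (mul_le_mul (low j) (low j.rev) (by norm_num) (by positivity)) (by positivity)

/-- The rescaled entry at `(i, j)` is comparable to the geometric mean of the antidiagonal entries
in row `i` and in column `j`. -/
theorem norm_rescale_le_antidiag (N : ℕ) {γ δ : ℝ} {lam1 : ℂ} (a : ℕ → ℂ) (x t : ℝ)
    (hτ : tauParam γ δ lam1 t ≠ 0) (i j : Fin N) :
    ‖Complex.exp (2 * theta1 N γ δ lam1 a x t)‖ * (‖scaleD N (tauParam γ δ lam1 t) i‖ *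
        ‖scaleD N (tauParam γ δ lam1 t) j‖⁻¹) ≤
      N.factorial * (√‖antidiag N γ δ lam1 a x t i‖ * √‖antidiag N γ δ lam1 a x t j.rev‖) := by
  set E := ‖Complex.exp (2 * theta1 N γ δ lam1 a x t)‖ with hE
  set d := fun i => ‖scaleD N (tauParam γ δ lam1 t) i‖ with hd
  have hd0 : ∀ i, 0 < d i := fun i => norm_pos_iff.mpr (scaleD_ne_zero N hτ i)
  have hσ : ∀ i, ‖antidiag N γ δ lam1 a x t i‖ = E * (d i * (d i.rev)⁻¹) := by
    intro i
    simp [antidiag, hE, hd]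
  rw [← Real.sqrt_mul (norm_nonneg _), hσ, hσ, Fin.rev_rev]
  refine le_of_sq_le_sq ?_ (by positivity)
  have hnn : 0 ≤ E * (d i * (d i.rev)⁻¹) * (E * (d j.rev * (d j)⁻¹)) := by
    have := (hd0 i).le
    have := (hd0 i.rev).le
    have := (hd0 j).le
    have := (hd0 j.rev).le
    positivity
  rw [mul_pow (N.factorial : ℝ), Real.sq_sqrt hnn]
  have h := norm_scaleD_mul_rev_le hτ i j
  change d i * d i.rev ≤ (N.factorial : ℝ) ^ 2 * (d j * d j.rev) at h
  have h1 := hd0 i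
  have h2 := hd0 i.rev
  have h3 := hd0 j
  have h4 := hd0 j.rev
  have e1 : (E * (d i * (d j)⁻¹)) ^ 2 =
      E ^ 2 * (d i * (d i.rev)⁻¹ * ((d j)⁻¹ * (d j)⁻¹)) * (d i * d i.rev) := by
    field_simp
  have e2 : (N.factorial : ℝ) ^ 2 * (E * (d i * (d i.rev)⁻¹) * (E * (d j.rev * (d j)⁻¹))) =
      E ^ 2 * (d i * (d i.rev)⁻¹ * ((d j)⁻¹ * (d j)⁻¹)) *
        ((N.factorial : ℝ) ^ 2 * (d j * d j.rev)) := by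
    field_simp
  change (E * (d i * (d j)⁻¹)) ^ 2 ≤ _
  rw [e1, e2]
  exact mul_le_mul_of_nonneg_left h (by positivity)

/-- The Bruhat factorisation of the Pascal matrix, carried through the rescaling, brings `conjF`
into the scope of `antidiagonal_perturbation`: the lower triangular factors rescale to the
identity, and the error of `rescaled_near` keeps its size relative to the antidiagonal. -/
theorem soliton_near (N : ℕ) [NeZero N] {γ δ : ℝ} {lam1 : ℂ} (hlam : 0 < lam1.im)
    (hC : coeffC γ δ lam1 ≠ 0) (a : ℕ → ℂ) (K : ℝ) (hK : 0 ≤ K) :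
    ∃ C T : ℝ, 0 ≤ C ∧ ∀ x t : ℝ, T ≤ |t| → |x - velocity γ δ lam1 * t| ≤ K * Real.log |t| →
      ‖soliton N γ δ lam1 a x t - leadingTerm N γ δ lam1 a x t‖ ≤
        C * (Real.log |t| / |t|) := by
  obtain ⟨M, hM0, hM⟩ := rescaled_near N hlam hC a K hK
  obtain ⟨C, η₀, hC0, hη₀, hpert⟩ := antidiagonal_perturbation N
  obtain ⟨mL, hmL0, hmL⟩ := exists_entry_bound (lowerPascalInv N)
  set b : ℝ := 2 * lam1.im * ‖coeffC γ δ lam1‖ with hb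
  have hb0 : 0 < b := by
    have := norm_pos_iff.mpr hC
    positivity
  set q : ℝ := mL * N.factorial / b + N * (N * (mL * M) * mL) * N.factorial with hq
  have hq1 : 0 ≤ mL * N.factorial / b := by positivity
  have hq2 : 0 ≤ N * (N * (mL * M) * mL) * N.factorial := by positivity
  obtain ⟨T, hT⟩ := exists_large_time b q η₀ hb0 hη₀
  refine ⟨4 * lam1.im * (C * q), T, by positivity, ?_⟩
  intro x t ht hx
  obtain ⟨ht1, hlog, hbt, hqη⟩ := hT |t| ht
  set η := Real.log |t| / |t| with hη
  have ht0 : 0 < |t| := by linarith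
  have hη0 : 0 ≤ η := by positivity
  set τ := tauParam γ δ lam1 t with hτdef
  have hτn : ‖τ‖ = b * |t| := norm_tauParam γ δ hlam t
  have hτ1 : 1 ≤ ‖τ‖ := by rwa [hτn]
  have hτ0 : τ ≠ 0 := by rw [← norm_pos_iff]; linarith
  have hd : ∀ i, scaleD N τ i ≠ 0 := scaleD_ne_zero N hτ0
  set E := Complex.exp (2 * theta1 N γ δ lam1 a x t) with hE
  set S := cholB N lam1 * matT N γ δ lam1 a x t * cholBInv N lam1 with hS
  set Δ := rescale (scaleD N τ)⁻¹ S - pascal N with hΔ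
  have hΔb : ∀ i j, ‖Δ i j‖ ≤ M * η := hM x t ht1 hlog hτ1 hx
  set L' := lowerPascalInv N with hL'
  obtain ⟨X, Y, hX, hY, hsol⟩ := soliton_eq N γ δ lam1 hlam.ne' a x t
  have hL'L : L' * lowerPascal N = 1 := mul_eq_one_comm.mp (lowerPascal_mul_inv N)
  have hLL' : lowerPascal N * L' = 1 := lowerPascal_mul_inv N
  have hprod : L' * (rescale (scaleD N τ)⁻¹ S) * L' = signedRev N + L' * Δ * L' := by
    have h1 : L' * pascal N * L' = signedRev N := by
      rw [pascal_eq_lower_mul]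
      calc L' * (lowerPascal N * signedRev N * lowerPascal N) * L'
          = (L' * lowerPascal N) * signedRev N * (lowerPascal N * L') := by noncomm_ring
        _ = signedRev N := by rw [hL'L, hLL', Matrix.one_mul, Matrix.mul_one]
    rw [← h1, hΔ]
    noncomm_ring
  have hcore : rescale (scaleD N τ) L' * conjF N γ δ lam1 a x t * rescale (scaleD N τ) L' =
      E • (rescale (scaleD N τ) (signedRev N + L' * Δ * L')) := by
    rw [← hprod, rescale_mul hd, rescale_mul hd, rescale_rescale_inv hd, conjF_eq_smul,
      Matrix.mul_smul, Matrix.smul_mul]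
  have hbound := hpert (conjF N γ δ lam1 a x t) (rescale (scaleD N τ) (lowerPascal N))
    (rescale (scaleD N τ) L') (E • rescale (scaleD N τ) (L' * Δ * L'))
    (rescale (scaleD N τ) L' - 1) (antidiag N γ δ lam1 a x t) (altVec N) (altVec N) X Y
    (fun i => √‖antidiag N γ δ lam1 a x t i‖) (q * η) (by positivity) hqη
    (fun i => Real.sqrt_nonneg _) (fun i => (Real.sq_sqrt (norm_nonneg _)).symm)
    (by rw [← rescale_mul hd, hL'L, rescale_one hd]) (by abel) ?_ ?_ ?_
    (fun i => (norm_altVec N i).le) (fun i => (norm_altVec N i).le) hX hY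
  · rw [hsol, leadingTerm, ← mul_sub, norm_mul]
    have h1 : ‖-4 * Complex.I * (lam1.im : ℂ)‖ = 4 * lam1.im := by
      simp [abs_of_pos hlam]
    rw [h1]
    calc _ ≤ 4 * lam1.im * (C * (q * η)) := by gcongr
      _ = _ := by ring
  · intro i j
    have hdiag : (1 : Matrix (Fin N) (Fin N) ℂ) = Matrix.diagonal fun i => L' i i := by
      rw [← Matrix.diagonal_one]
      congr 1
      ext i
      simp [hL', lowerPascalInv, pascalInv, ← two_mul, pow_mul]
    rw [hdiag]
    refine (rescale_lower hmL0 hmL ?_ hτ1 i j).trans ?_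
    · intro i j hij
      have : (j.rev : ℕ) < i.rev := Fin.lt_def.mp (Fin.rev_lt_rev.mpr hij)
      simp only [hL', lowerPascalInv, pascalInv, Matrix.submatrix_apply, Matrix.of_apply]
      rw [Nat.choose_eq_zero_of_lt this]
      simp
    · calc mL * N.factorial / ‖τ‖ ≤ mL * N.factorial / b * η := by
            rw [hτn, hη, div_mul_div_comm]
            exact div_le_div_of_nonneg_right (le_mul_of_one_le_right (by positivity) hlog)
              (by positivity)
        _ ≤ q * η := mul_le_mul_of_nonneg_right (by rw [hq]; linarith) hη0
  · intro i j
    rw [hcore, Matrix.smul_apply, Matrix.smul_apply, rescale, rescale, Matrix.of_apply,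
      Matrix.of_apply, Matrix.add_apply, signedRev, Matrix.of_apply, mul_add, add_mul, smul_add]
    congr 1
    split_ifs with h
    · subst h
      rw [antidiag, smul_eq_mul]
      ring
    · simp
  · intro i j
    rw [Matrix.smul_apply, rescale, Matrix.of_apply, smul_eq_mul, norm_mul, norm_mul, norm_mul,
      norm_inv]
    have h1 : ‖(L' * Δ * L') i j‖ ≤ N * (N * (mL * (M * η)) * mL) :=
      norm_mul_apply_le (L' * Δ) L' _ _ (by positivity)
        (norm_mul_apply_le L' Δ _ _ hmL0 hmL hΔb) hmL i j
    have h2 := norm_rescale_le_antidiag N a x t hτ0 i j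
    set g := √‖antidiag N γ δ lam1 a x t i‖ * √‖antidiag N γ δ lam1 a x t j.rev‖ with hg
    have hg0 : 0 ≤ g := by positivity
    calc ‖E‖ * (‖scaleD N τ i‖ * ‖(L' * Δ * L') i j‖ * ‖scaleD N τ j‖⁻¹)
        = (‖E‖ * (‖scaleD N τ i‖ * ‖scaleD N τ j‖⁻¹)) * ‖(L' * Δ * L') i j‖ := by ring
      _ ≤ (N.factorial * g) * (N * (N * (mL * (M * η)) * mL)) :=
          mul_le_mul h2 h1 (norm_nonneg _) (by positivity)
      _ = N * (N * (mL * M) * mL) * N.factorial * (η * g) := by ring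
      _ ≤ q * (η * g) := mul_le_mul_of_nonneg_right (by rw [hq]; linarith) (by positivity)
      _ = _ := by ring

/-! ### The region of fast decay -/

theorem norm_exp_two_theta1 (N : ℕ) [NeZero N] (γ δ : ℝ) (lam1 : ℂ) (a : ℕ → ℂ) (x t : ℝ) :
    ‖Complex.exp (2 * theta1 N γ δ lam1 a x t)‖ =
      Real.exp (-2 * lam1.im * (x - velocity γ δ lam1 * t) + 2 * (a 0).re) := by
  rw [Complex.norm_exp]
  congr 1
  have hsum : ∑ j ∈ Finset.range N, a j * (lam1 - lam1) ^ j = a 0 := by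
    rw [Finset.sum_eq_single_of_mem 0 (Finset.mem_range.mpr (NeZero.pos N))]
    · simp
    · intro j _ hj
      simp [hj]
  rw [theta1, theta, hsum]
  simp [velocity, pow_two]
  ring

/-- An exponentially small quantity beats polynomial growth once `|s| ≥ K log |t|`. -/
theorem decay_bound (M : ℕ) {l : ℝ} (hl : 0 < l) (c A : ℝ) (hA : 0 ≤ A) :
    ∃ C : ℝ, 0 ≤ C ∧ ∀ s t v E : ℝ, 1 ≤ |t| → 1 ≤ Real.log |t| → (M + 1) / l * Real.log |t| ≤ |s| →
      E = Real.exp (-2 * l * s + c) → v ≤ A * (E * (1 + |s| + |t|) ^ M) →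
      v ≤ A * (E⁻¹ * (1 + |s| + |t|) ^ M) → v ≤ C * (Real.log |t| / |t|) := by
  set c2 : ℝ := M.factorial * Real.exp l / l ^ M with hc2
  have hc2n : 0 ≤ c2 := by positivity
  have hpoly : ∀ y : ℝ, 0 ≤ y → (1 + y) ^ M * Real.exp (-l * y) ≤ c2 := by
    intro y hy
    have h := Real.pow_div_factorial_le_exp (l * (1 + y)) (by positivity) M
    rw [div_le_iff₀ (by positivity), mul_pow] at h
    have h1 : Real.exp (l * (1 + y)) = Real.exp l * Real.exp (l * y) := by
      rw [← Real.exp_add]; congr 1; ring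
    rw [hc2, le_div_iff₀ (by positivity), neg_mul, Real.exp_neg]
    have h2 := Real.exp_pos (l * y)
    rw [h1] at h
    calc (1 + y) ^ M * (Real.exp (l * y))⁻¹ * l ^ M
        = l ^ M * (1 + y) ^ M * (Real.exp (l * y))⁻¹ := by ring
      _ ≤ Real.exp l * Real.exp (l * y) * M.factorial * (Real.exp (l * y))⁻¹ := by gcongr
      _ = _ := by field_simp
  refine ⟨A * Real.exp |c| * c2 * 2 ^ M, by positivity, ?_⟩
  intro s t v E ht hlog hs hE h1 h2
  have ht0 : 0 < |t| := by linarith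
  have hs0 : 0 ≤ |s| := abs_nonneg s
  have hv : v ≤ A * (Real.exp |c| * Real.exp (-2 * l * |s|) * (1 + |s| + |t|) ^ M) := by
    rcases le_total 0 s with h | h
    · refine h1.trans ?_
      gcongr
      rw [hE, ← Real.exp_add, abs_of_nonneg h]
      exact Real.exp_le_exp.mpr (by linarith [le_abs_self c])
    · refine h2.trans ?_
      gcongr
      rw [hE, ← Real.exp_neg, ← Real.exp_add, abs_of_nonpos h]
      exact Real.exp_le_exp.mpr (by linarith [neg_abs_le c])
  have hW : (1 + |s| + |t|) ^ M ≤ (1 + |s|) ^ M * (2 ^ M * |t| ^ M) := by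
    rw [← mul_pow, ← mul_pow]
    refine pow_le_pow_left₀ (by positivity) ?_ M
    nlinarith
  have hsmall : Real.exp (-l * |s|) ≤ (|t| ^ (M + 1))⁻¹ := by
    have h3 : |t| ^ (M + 1) = Real.exp ((M + 1 : ℕ) * Real.log |t|) := by
      rw [← Real.log_pow, Real.exp_log (by positivity)]
    rw [h3, ← Real.exp_neg]
    refine Real.exp_le_exp.mpr ?_
    have h4 := mul_le_mul_of_nonneg_left hs hl.le
    have h5 : l * ((M + 1) / l * Real.log |t|) = (M + 1) * Real.log |t| := by field_simp
    push_cast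
    linarith
  have hexp : Real.exp (-2 * l * |s|) = Real.exp (-l * |s|) * Real.exp (-l * |s|) := by
    rw [← Real.exp_add]; congr 1; ring
  calc v ≤ A * (Real.exp |c| * Real.exp (-2 * l * |s|) * (1 + |s| + |t|) ^ M) := hv
    _ ≤ A * (Real.exp |c| * Real.exp (-2 * l * |s|) *
        ((1 + |s|) ^ M * (2 ^ M * |t| ^ M))) := by gcongr
    _ = A * Real.exp |c| * ((1 + |s|) ^ M * Real.exp (-l * |s|)) * 2 ^ M *
        (Real.exp (-l * |s|) * |t| ^ M) := by rw [hexp]; ring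
    _ ≤ A * Real.exp |c| * c2 * 2 ^ M * ((|t| ^ (M + 1))⁻¹ * |t| ^ M) := by
        gcongr
        exact hpoly _ hs0
    _ = A * Real.exp |c| * c2 * 2 ^ M * (1 / |t|) := by
        rw [pow_succ]; field_simp
    _ ≤ _ := by gcongr

/-- A polynomial bound on the Taylor coefficients for all `x` and `t`: the case `ω = 0` of
`recurrence_bound`. -/
theorem taylorCoeff_bound (N : ℕ) (γ δ : ℝ) (lam1 : ℂ) (a : ℕ → ℂ) :
    ∃ C : ℕ → ℝ, (∀ l, 0 ≤ C l) ∧ ∀ x t : ℝ, ∀ l, ‖taylorCoeff N γ δ lam1 a x t l‖ ≤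
      C l * (1 + |x - velocity γ δ lam1 * t| + |t|) ^ l := by
  obtain ⟨B, hB0, hB⟩ := phasePoly_bound N γ δ lam1 a
  choose C hC0 hC using recurrence_bound (fun k => |B k|)
  refine ⟨fun l => C l + 1, fun l => add_nonneg (hC0 l) zero_le_one, ?_⟩
  intro x t l
  set s := x - velocity γ δ lam1 * t with hs
  set W := 1 + |s| + |t| with hW
  have hs0 := abs_nonneg s
  have ht0 := abs_nonneg t
  have hW1 : 1 ≤ W := by rw [hW]; linarith
  have hBn : ‖coeffC γ δ lam1‖ ≤ |B 0| := hB0.trans (le_abs_self _)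
  have h := hC l (taylorCoeff N γ δ lam1 a x t)
    (fun k => (phasePoly N γ δ lam1 a x t).derivative.coeff k) 0 W 1
    (taylorCoeff_zero ..) (taylorCoeff_succ N γ δ lam1 a x t) hW1 le_rfl (by linarith)
    (by rw [norm_zero]; positivity) ?_ ?_
  · have h1 := norm_le_norm_sub_add (taylorCoeff N γ δ lam1 a x t l) (0 ^ l / l.factorial)
    have h2 : ‖(0 ^ l / l.factorial : ℂ)‖ ≤ 1 := by
      rcases Nat.eq_zero_or_pos l with h0 | h0
      · subst h0; simp
      · simp [h0.ne']
    have h3 : 1 ≤ W ^ l := one_le_pow₀ hW1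
    rw [mul_one] at h
    linarith
  · have h1 := (hB x t).1
    have h2 := norm_le_norm_sub_add ((phasePoly N γ δ lam1 a x t).derivative.coeff 0)
      (conj (coeffC γ δ lam1) * t)
    rw [norm_mul, RCLike.norm_conj, Complex.norm_real, Real.norm_eq_abs] at h2
    have h3 : ‖coeffC γ δ lam1‖ * |t| ≤ |B 0| * |t| := by gcongr
    have h4 : B 0 * (1 + |s|) ≤ |B 0| * (1 + |s|) := by
      gcongr
      exact le_abs_self _
    rw [sub_zero, mul_one, hW]
    linarith
  · intro k
    refine ((hB x t).2 k).trans ?_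
    refine mul_le_mul (le_abs_self _) ?_ (by positivity) (abs_nonneg _)
    rw [hW]; linarith

theorem matT_bound (N : ℕ) (γ δ : ℝ) (lam1 : ℂ) (a : ℕ → ℂ) :
    ∃ c : ℝ, 1 ≤ c ∧ ∀ x t : ℝ, ∀ i j, ‖matT N γ δ lam1 a x t i j‖ ≤
      c * (1 + |x - velocity γ δ lam1 * t| + |t|) ^ N := by
  obtain ⟨C, hC0, hC⟩ := taylorCoeff_bound N γ δ lam1 a
  have hsum : 0 ≤ ∑ l ∈ Finset.range N, C l := Finset.sum_nonneg fun l _ => hC0 l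
  refine ⟨1 + ∑ l ∈ Finset.range N, C l, by linarith, ?_⟩
  intro x t i j
  have hW1 : 1 ≤ 1 + |x - velocity γ δ lam1 * t| + |t| := by
    have := abs_nonneg (x - velocity γ δ lam1 * t)
    have := abs_nonneg t
    linarith
  rw [matT, Matrix.of_apply]
  split_ifs with h
  · have hj := j.2
    have hl : (j : ℕ) - i ∈ Finset.range N := Finset.mem_range.mpr (by omega)
    have h1 := Finset.single_le_sum (f := C) (fun l _ => hC0 l) hl
    refine (hC x t _).trans (mul_le_mul (by linarith) ?_ (by positivity) (by linarith))
    exact pow_le_pow_right₀ hW1 (by omega)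
  · rw [norm_zero]
    positivity

theorem det_matT (N : ℕ) (γ δ : ℝ) (lam1 : ℂ) (a : ℕ → ℂ) (x t : ℝ) :
    (matT N γ δ lam1 a x t).det = 1 := by
  rw [Matrix.det_of_isUpperTriangular]
  · simp [matT, taylorCoeff_zero]
  · intro i j h
    simp only [matT, Matrix.of_apply]
    have h' : j < i := h
    rw [if_neg (not_le.mpr h')]

theorem norm_adjugate_le {N : ℕ} (H : Matrix (Fin N) (Fin N) ℂ) {c : ℝ} (hc : 1 ≤ c)
    (hH : ∀ i j, ‖H i j‖ ≤ c) (i j : Fin N) : ‖H.adjugate i j‖ ≤ N.factorial * c ^ N := by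
  rw [Matrix.adjugate_apply]
  have h := Matrix.det_le (A := H.updateRow j (Pi.single i 1)) 
    (abv := (⟨⟨norm, norm_mul⟩, norm_nonneg, fun _ => norm_eq_zero, norm_add_le⟩ :
      AbsoluteValue ℂ ℝ)) (x := c) ?_
  · rw [nsmul_eq_mul, Fintype.card_fin] at h
    exact h
  · intro k l
    change ‖H.updateRow j (Pi.single i 1) k l‖ ≤ c
    rw [Matrix.updateRow_apply]
    split_ifs
    · rw [Pi.single_apply]
      split_ifs
      · simpa using hc
      · simpa using zero_le_one.trans hc
    · exact hH k l

/-- The soliton is controlled both by `A` and by its inverse, and hence by `|E|` and `|E|⁻¹` up to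
polynomial factors, where `E = exp (2 θ₁)`. -/
theorem soliton_crude_bound (N : ℕ) [NeZero N] (γ δ : ℝ) {lam1 : ℂ} (hlam : 0 < lam1.im)
    (a : ℕ → ℂ) :
    ∃ C : ℝ, 0 ≤ C ∧ ∀ x t : ℝ,
      (‖soliton N γ δ lam1 a x t‖ ≤ C * (‖Complex.exp (2 * theta1 N γ δ lam1 a x t)‖ *
        (1 + |x - velocity γ δ lam1 * t| + |t|) ^ (N * N))) ∧
      (‖soliton N γ δ lam1 a x t‖ ≤ C * (‖Complex.exp (2 * theta1 N γ δ lam1 a x t)‖⁻¹ *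
        (1 + |x - velocity γ δ lam1 * t| + |t|) ^ (N * N))) := by
  obtain ⟨c, hc1, hc⟩ := matT_bound N γ δ lam1 a
  obtain ⟨mU, hmU0, hmU⟩ := exists_entry_bound (cholB N lam1)
  obtain ⟨mV, hmV0, hmV⟩ := exists_entry_bound (cholBInv N lam1)
  have hc0 : 0 ≤ c := by linarith
  have hN1 : 1 ≤ N := NeZero.one_le
  set C₁ : ℝ := N * (N * (mU * c) * mV) * (N * (N + 2)) with hC₁
  set C₂ : ℝ := N * (N * (mU * (N.factorial * c ^ N)) * mV) * (N * (N + 2)) with hC₂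
  have hC₁0 : 0 ≤ C₁ := by positivity
  have hC₂0 : 0 ≤ C₂ := by positivity
  refine ⟨4 * lam1.im * (N * (C₁ + C₂)), by positivity, ?_⟩
  intro x t
  set W := 1 + |x - velocity γ δ lam1 * t| + |t| with hW
  have hW1 : 1 ≤ W := by
    have := abs_nonneg (x - velocity γ δ lam1 * t)
    have := abs_nonneg t
    rw [hW]; linarith
  set E := Complex.exp (2 * theta1 N γ δ lam1 a x t) with hE
  have hE0 : E ≠ 0 := Complex.exp_ne_zero _
  set A := conjF N γ δ lam1 a x t with hA
  set S := cholB N lam1 * matT N γ δ lam1 a x t * cholBInv N lam1 with hS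
  have hAS : A = E • S := conjF_eq_smul N γ δ lam1 a x t
  obtain ⟨X, Y, hX, hY, hsol⟩ := soliton_eq N γ δ lam1 hlam.ne' a x t
  have hYb : ∀ j, ‖Y j‖ ≤ N + 1 := norm_le_of_system A (altVec N) X Y
    (fun i => (norm_altVec N i).le) hX hY
  have hYs : ∑ j, ‖Y j‖ ≤ N * (N + 2) := by
    calc ∑ j, ‖Y j‖ ≤ ∑ _j : Fin N, ((N : ℝ) + 2) :=
          Finset.sum_le_sum fun j _ => (hYb j).trans (by linarith)
      _ = _ := by rw [Finset.sum_const, Finset.card_univ, Fintype.card_fin, nsmul_eq_mul]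
  have hbYs : ∑ j, ‖altVec N j - Y j‖ ≤ N * (N + 2) := by
    calc ∑ j, ‖altVec N j - Y j‖ ≤ ∑ _j : Fin N, ((N : ℝ) + 2) :=
          Finset.sum_le_sum fun j _ => (norm_sub_le _ _).trans (by
            rw [norm_altVec]; linarith [hYb j])
      _ = _ := by rw [Finset.sum_const, Finset.card_univ, Fintype.card_fin, nsmul_eq_mul]
  have hsb : ∀ v : ℝ, (∀ i, ‖X i‖ ≤ v) →
      ‖soliton N γ δ lam1 a x t‖ ≤ 4 * lam1.im * (N * v) := by
    intro v hv
    have h1 : ‖-4 * Complex.I * (lam1.im : ℂ)‖ = 4 * lam1.im := by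
      simp [abs_of_pos hlam]
    rw [hsol, norm_mul, h1]
    refine mul_le_mul_of_nonneg_left ?_ (by positivity)
    rw [dotProduct]
    refine (norm_sum_le _ _).trans ?_
    calc ∑ i, ‖altVec N i * X i‖ ≤ ∑ _i : Fin N, v :=
          Finset.sum_le_sum fun i _ => by rw [norm_mul, norm_altVec, one_mul]; exact hv i
      _ = N * v := by simp
  have hWN : W ^ N ≤ W ^ (N * N) := pow_le_pow_right₀ hW1 (Nat.le_mul_of_pos_left N hN1)
  constructor
  · have hSb : ∀ i j, ‖S i j‖ ≤ N * (N * (mU * (c * W ^ N)) * mV) :=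
      norm_mul_apply_le _ _ _ _ (by positivity)
        (norm_mul_apply_le _ _ _ _ hmU0 hmU (hc x t)) hmV
    have hAb : ∀ i j, ‖Aᴴ i j‖ ≤ ‖E‖ * (N * (N * (mU * (c * W ^ N)) * mV)) := by
      intro i j
      rw [Matrix.conjTranspose_apply, norm_star, hAS, Matrix.smul_apply, smul_eq_mul, norm_mul]
      exact mul_le_mul_of_nonneg_left (hSb j i) (norm_nonneg _)
    refine (hsb (‖E‖ * (N * (N * (mU * (c * W ^ N)) * mV)) * (N * (N + 2))) fun i => ?_).trans ?_
    · rw [hX]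
      exact (norm_mulVec_le _ _ _ hAb i).trans
        (mul_le_mul_of_nonneg_left hYs (by positivity))
    · calc _ = 4 * lam1.im * (N * C₁) * (‖E‖ * W ^ N) := by rw [hC₁]; ring
        _ ≤ 4 * lam1.im * (N * (C₁ + C₂)) * (‖E‖ * W ^ (N * N)) := by
            gcongr
            linarith
  · set S' := cholB N lam1 * (matT N γ δ lam1 a x t).adjugate * cholBInv N lam1 with hS'
    have hS'S : S' * S = 1 := by
      have h1 := Matrix.adjugate_mul (matT N γ δ lam1 a x t)
      rw [det_matT, one_smul] at h1
      have h2 := cholBInv_mul_cholB N lam1 hlam.ne'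
      calc S' * S = cholB N lam1 * (matT N γ δ lam1 a x t).adjugate *
            (cholBInv N lam1 * cholB N lam1) * matT N γ δ lam1 a x t * cholBInv N lam1 := by
              rw [hS', hS]; noncomm_ring
        _ = cholB N lam1 * ((matT N γ δ lam1 a x t).adjugate * matT N γ δ lam1 a x t) *
            cholBInv N lam1 := by rw [h2]; noncomm_ring
        _ = 1 := by rw [h1, Matrix.mul_one, cholB_mul_cholBInv N lam1 hlam.ne']
    have hadj := norm_adjugate_le (matT N γ δ lam1 a x t) (c := c * W ^ N)
      (by nlinarith [one_le_pow₀ (n := N) hW1]) (hc x t)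
    have hS'b : ∀ i j, ‖S' i j‖ ≤ N * (N * (mU * (N.factorial * (c * W ^ N) ^ N)) * mV) :=
      norm_mul_apply_le _ _ _ _ (by positivity)
        (norm_mul_apply_le _ _ _ _ hmU0 hmU hadj) hmV
    have hXe : X = E⁻¹ • (S' *ᵥ fun j => altVec N j - Y j) := by
      have h3 : (fun j => altVec N j - Y j) = E • (S *ᵥ X) := by
        rw [← Matrix.smul_mulVec, ← hAS, ← hY]
        ext j
        simp [hA]
      rw [h3, Matrix.mulVec_smul, Matrix.mulVec_mulVec, hS'S, Matrix.one_mulVec, smul_smul,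
        inv_mul_cancel₀ hE0, one_smul]
    refine (hsb (‖E‖⁻¹ * ((N * (N * (mU * (N.factorial * (c * W ^ N) ^ N)) * mV)) *
      (N * (N + 2)))) fun i => ?_).trans ?_
    · rw [hXe, Pi.smul_apply, smul_eq_mul, norm_mul, norm_inv]
      refine mul_le_mul_of_nonneg_left ?_ (by positivity)
      exact (norm_mulVec_le _ _ _ hS'b i).trans
        (mul_le_mul_of_nonneg_left hbYs (by positivity))
    · calc _ = 4 * lam1.im * (N * C₂) * (‖E‖⁻¹ * W ^ (N * N)) := by
            rw [hC₂, mul_pow, ← pow_mul]; ring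
        _ ≤ 4 * lam1.im * (N * (C₁ + C₂)) * (‖E‖⁻¹ * W ^ (N * N)) := by
            gcongr
            linarith

theorem scaleD_ratio_le {N : ℕ} {τ : ℂ} (hτ : 1 ≤ ‖τ‖) (i j : Fin N) :
    ‖scaleD N τ i‖ * ‖scaleD N τ j‖⁻¹ ≤ N.factorial * ‖τ‖ ^ N := by
  have hτ0 : 0 < ‖τ‖ := by linarith
  have hi : ((i : ℕ).factorial : ℝ) ≤ N.factorial := by
    exact_mod_cast Nat.factorial_le i.2.le
  have hj : (1 : ℝ) ≤ (j : ℕ).factorial := by exact_mod_cast (j : ℕ).factorial_pos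
  have hp : ‖τ‖ ^ (j : ℕ) ≤ ‖τ‖ ^ N := pow_le_pow_right₀ hτ j.2.le
  have hq : 1 ≤ ‖τ‖ ^ (i : ℕ) := one_le_pow₀ hτ
  rw [norm_scaleD, norm_scaleD, inv_div, div_mul_div_comm]
  calc _ ≤ ((i : ℕ).factorial : ℝ) * ‖τ‖ ^ (j : ℕ) :=
        div_le_self (by positivity) (by nlinarith)
    _ ≤ _ := mul_le_mul hi hp (by positivity) (by positivity)

theorem leadingTerm_crude_bound (N : ℕ) [NeZero N] (γ δ : ℝ) {lam1 : ℂ} (hlam : 0 < lam1.im)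
    (a : ℕ → ℂ) :
    ∃ C : ℝ, 0 ≤ C ∧ ∀ x t : ℝ, 1 ≤ ‖tauParam γ δ lam1 t‖ →
      (‖leadingTerm N γ δ lam1 a x t‖ ≤ C * (‖Complex.exp (2 * theta1 N γ δ lam1 a x t)‖ *
        (1 + |x - velocity γ δ lam1 * t| + |t|) ^ (N * N))) ∧
      (‖leadingTerm N γ δ lam1 a x t‖ ≤ C * (‖Complex.exp (2 * theta1 N γ δ lam1 a x t)‖⁻¹ *
        (1 + |x - velocity γ δ lam1 * t| + |t|) ^ (N * N))) := by
  set b : ℝ := 2 * lam1.im * ‖coeffC γ δ lam1‖ with hb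
  have hb0 : 0 ≤ b := by positivity
  have hN1 : 1 ≤ N := NeZero.one_le
  refine ⟨4 * lam1.im * (N * (N.factorial * b ^ N)), by positivity, ?_⟩
  intro x t hτ
  have hτ0 : tauParam γ δ lam1 t ≠ 0 := by rw [← norm_pos_iff]; linarith
  set W := 1 + |x - velocity γ δ lam1 * t| + |t| with hW
  have hs0 := abs_nonneg (x - velocity γ δ lam1 * t)
  have hW1 : 1 ≤ W := by
    have := abs_nonneg t
    rw [hW]; linarith
  set E := Complex.exp (2 * theta1 N γ δ lam1 a x t) with hE
  have hE0 : E ≠ 0 := Complex.exp_ne_zero _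
  have hWN : W ^ N ≤ W ^ (N * N) := pow_le_pow_right₀ hW1 (Nat.le_mul_of_pos_left N hN1)
  have hratio : ∀ i j : Fin N, ‖scaleD N (tauParam γ δ lam1 t) i‖ *
      ‖scaleD N (tauParam γ δ lam1 t) j‖⁻¹ ≤ N.factorial * b ^ N * W ^ (N * N) := by
    intro i j
    refine (scaleD_ratio_le hτ i j).trans ?_
    rw [norm_tauParam γ δ hlam, ← hb, mul_pow, mul_assoc]
    gcongr
    refine (pow_le_pow_left₀ (abs_nonneg t) ?_ N).trans hWN
    rw [hW]; linarith
  have hσ : ∀ i, ‖antidiag N γ δ lam1 a x t i‖ = ‖E‖ * (‖scaleD N (tauParam γ δ lam1 t) i‖ *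
      ‖scaleD N (tauParam γ δ lam1 t) i.rev‖⁻¹) := by
    intro i
    simp [antidiag, hE]
  have hsb : ∀ v : ℝ, (∀ i, ‖antidiag N γ δ lam1 a x t i‖ /
      (1 + ‖antidiag N γ δ lam1 a x t i‖ ^ 2) ≤ v) →
      ‖leadingTerm N γ δ lam1 a x t‖ ≤ 4 * lam1.im * (N * v) := by
    intro v hv
    have h1 : ‖-4 * Complex.I * (lam1.im : ℂ)‖ = 4 * lam1.im := by
      simp [abs_of_pos hlam]
    rw [leadingTerm, norm_mul, h1]
    refine mul_le_mul_of_nonneg_left ?_ (by positivity)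
    refine (norm_sum_le _ _).trans ?_
    calc _ ≤ ∑ _i : Fin N, v := by
          refine Finset.sum_le_sum fun i _ => ?_
          refine le_trans (le_of_eq ?_) (hv i)
          have h2 : ‖(1 + (‖antidiag N γ δ lam1 a x t i‖ : ℂ) ^ 2)‖ =
              1 + ‖antidiag N γ δ lam1 a x t i‖ ^ 2 := by
            have h3 : (1 + (‖antidiag N γ δ lam1 a x t i‖ : ℂ) ^ 2) =
              ((1 + ‖antidiag N γ δ lam1 a x t i‖ ^ 2 : ℝ) : ℂ) := by push_cast; ring
            rw [h3, Complex.norm_real, Real.norm_of_nonneg (by positivity)]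
          rw [norm_mul, norm_div, norm_mul, norm_altVec, norm_altVec, RCLike.norm_conj, h2]
          ring
      _ = N * v := by simp
  constructor
  · refine (hsb (N.factorial * b ^ N * (‖E‖ * W ^ (N * N))) fun i => ?_).trans (le_of_eq (by ring))
    refine (div_le_self (norm_nonneg _) (by
      have := sq_nonneg ‖antidiag N γ δ lam1 a x t i‖
      linarith)).trans ?_
    rw [hσ]
    calc _ ≤ ‖E‖ * (N.factorial * b ^ N * W ^ (N * N)) :=
          mul_le_mul_of_nonneg_left (hratio _ _) (norm_nonneg _)
      _ = _ := by ring
  · refine (hsb (N.factorial * b ^ N * (‖E‖⁻¹ * W ^ (N * N))) fun i => ?_).trans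
      (le_of_eq (by ring))
    have hd1 := norm_pos_iff.mpr (scaleD_ne_zero N hτ0 i)
    have hd2 := norm_pos_iff.mpr (scaleD_ne_zero N hτ0 i.rev)
    have hEp := norm_pos_iff.mpr hE0
    have hpos : 0 < ‖antidiag N γ δ lam1 a x t i‖ := by
      rw [hσ]; positivity
    have h1 : ‖antidiag N γ δ lam1 a x t i‖ / (1 + ‖antidiag N γ δ lam1 a x t i‖ ^ 2) ≤
        ‖antidiag N γ δ lam1 a x t i‖⁻¹ := by
      rw [div_le_iff₀ (by positivity), mul_add, pow_two, inv_mul_cancel_left₀ hpos.ne']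
      have := inv_pos.mpr hpos
      linarith
    refine h1.trans ?_
    rw [hσ, mul_inv, mul_inv, inv_inv]
    calc ‖E‖⁻¹ * (‖scaleD N (tauParam γ δ lam1 t) i‖⁻¹ * ‖scaleD N (tauParam γ δ lam1 t) i.rev‖)
        = ‖E‖⁻¹ * (‖scaleD N (tauParam γ δ lam1 t) i.rev‖ *
          ‖scaleD N (tauParam γ δ lam1 t) i‖⁻¹) := by ring
      _ ≤ ‖E‖⁻¹ * (N.factorial * b ^ N * W ^ (N * N)) :=
          mul_le_mul_of_nonneg_left (hratio _ _) (by positivity)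
      _ = _ := by ring

/-- Both regions together, divided at `|x - v₁ t| = K log |t|` with `K` so large that exponential
decay beats the polynomial growth of degree `N²` outside. -/
theorem soliton_sub_leadingTerm_bound (N : ℕ) [NeZero N] {γ δ : ℝ} {lam1 : ℂ} (hlam : 0 < lam1.im)
    (hC : coeffC γ δ lam1 ≠ 0) (a : ℕ → ℂ) :
    ∃ C T : ℝ, ∀ x t : ℝ, T ≤ |t| →
      ‖soliton N γ δ lam1 a x t - leadingTerm N γ δ lam1 a x t‖ ≤
        C * (Real.log |t| / |t|) := by
  obtain ⟨C₁, hC₁, h₁⟩ := soliton_crude_bound N γ δ hlam a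
  obtain ⟨C₂, hC₂, h₂⟩ := leadingTerm_crude_bound N γ δ hlam a
  set K : ℝ := (((N * N : ℕ) : ℝ) + 1) / lam1.im with hK
  obtain ⟨D₁, hD₁, g₁⟩ := decay_bound (N * N) hlam (2 * (a 0).re) C₁ hC₁
  obtain ⟨D₂, hD₂, g₂⟩ := decay_bound (N * N) hlam (2 * (a 0).re) C₂ hC₂
  obtain ⟨C₃, T₁, hC₃, h₃⟩ := soliton_near N hlam hC a K (by positivity)
  obtain ⟨T₂, hT₂⟩ := exists_large_time (2 * lam1.im * ‖coeffC γ δ lam1‖) 0 1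
    (by have := norm_pos_iff.mpr hC; positivity) one_pos
  refine ⟨C₃ + D₁ + D₂, max T₁ T₂, ?_⟩
  intro x t ht
  obtain ⟨ht1, hlog, hτ, -⟩ := hT₂ |t| ((le_max_right _ _).trans ht)
  have hη : 0 ≤ Real.log |t| / |t| := by positivity
  rw [← norm_tauParam γ δ hlam] at hτ
  rcases le_total |x - velocity γ δ lam1 * t| (K * Real.log |t|) with h | h
  · refine (h₃ x t ((le_max_left _ _).trans ht) h).trans ?_
    exact mul_le_mul_of_nonneg_right (by linarith) hη
  · have e := norm_exp_two_theta1 N γ δ lam1 a x t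
    have b₁ := g₁ _ t _ _ ht1 hlog h e (h₁ x t).1 (h₁ x t).2
    have b₂ := g₂ _ t _ _ ht1 hlog h e (h₂ x t hτ).1 (h₂ x t hτ).2
    refine (norm_sub_le _ _).trans ?_
    have : 0 ≤ C₃ * (Real.log |t| / |t|) := by positivity
    linarith

/-! ### The leading term as a sum of hyperbolic secants -/

/-- The solution of the scalar system for `σ = ± exp w` is half a hyperbolic secant of `Re w` with
the phase of `σ*`. -/
theorem conj_div_one_add_sq (e : ℝ) (he : e ^ 2 = 1) (w : ℂ) :
    conj (e * Complex.exp w) / (1 + (‖(e : ℂ) * Complex.exp w‖ : ℂ) ^ 2) =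
      e * Complex.exp (-(Complex.I * w.im)) * sech w.re / 2 := by
  have hn : ‖(e : ℂ) * Complex.exp w‖ = Real.exp w.re := by
    have : |e| = 1 := by
      rw [← Real.sqrt_sq_eq_abs, he, Real.sqrt_one]
    rw [norm_mul, Complex.norm_exp, Complex.norm_real, Real.norm_eq_abs, this, one_mul]
  have hexp : conj (Complex.exp w) = Real.exp w.re * Complex.exp (-(Complex.I * w.im)) := by
    rw [← Complex.exp_conj, Complex.ofReal_exp, ← Complex.exp_add]
    congr 1
    apply Complex.ext <;> simp
  have hs : (sech w.re : ℂ) = 2 * Real.exp w.re / (1 + (Real.exp w.re : ℂ) ^ 2) := by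
    have h1 : sech w.re = 2 * Real.exp w.re / (1 + Real.exp w.re ^ 2) := by
      have hp := Real.exp_pos w.re
      rw [sech, Real.cosh_eq, Real.exp_neg]
      field_simp
      ring
    rw [h1]
    push_cast
    ring
  have hne : (1 + (Real.exp w.re : ℂ) ^ 2) ≠ 0 := by
    have : (1 + (Real.exp w.re : ℂ) ^ 2) = ((1 + Real.exp w.re ^ 2 : ℝ) : ℂ) := by push_cast; ring
    rw [this]
    exact_mod_cast (by positivity : (1 + Real.exp w.re ^ 2 : ℝ) ≠ 0)
  rw [map_mul, Complex.conj_ofReal, hexp, hn, hs]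
  field_simp

/-- A logarithm of the antidiagonal entry with index `k`, up to sign; its real part vanishes along
the `k`-th characteristic curve. -/
def logAntidiag (N : ℕ) (γ δ : ℝ) (lam1 : ℂ) (a : ℕ → ℂ) (x t : ℝ) (k : ℕ) : ℂ :=
  2 * theta1 N γ δ lam1 a x t + ((N : ℝ) - 1 - 2 * k : ℝ) *
      ((Real.log (2 * lam1.im) + Real.log ‖coeffC γ δ lam1‖ + Real.log |t| : ℝ)
        - Complex.I * (coeffC γ δ lam1).arg)
    + (Real.log ((k.factorial : ℝ) / ((N - 1 - k).factorial : ℝ)) : ℝ)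

theorem tauParam_eq {γ δ : ℝ} {lam1 : ℂ} (hlam : 0 < lam1.im) (hC : coeffC γ δ lam1 ≠ 0)
    {σ t : ℝ} (hσ : σ * |t| = t) (ht : t ≠ 0) :
    tauParam γ δ lam1 t = (-σ : ℝ) * Complex.exp
      ((Real.log (2 * lam1.im) + Real.log ‖coeffC γ δ lam1‖ + Real.log |t| : ℝ)
        - Complex.I * (coeffC γ δ lam1).arg) := by
  have hCn := norm_pos_iff.mpr hC
  have htn := abs_pos.mpr ht
  have hconj : conj (coeffC γ δ lam1) = ‖coeffC γ δ lam1‖ *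
      Complex.exp (-(Complex.I * (coeffC γ δ lam1).arg)) := by
    conv_lhs => rw [← Complex.norm_mul_exp_arg_mul_I (coeffC γ δ lam1)]
    rw [map_mul, Complex.conj_ofReal, ← Complex.exp_conj]
    congr 2
    simp
    ring
  have hreal : Real.exp (Real.log (2 * lam1.im) + Real.log ‖coeffC γ δ lam1‖ + Real.log |t|) =
      2 * lam1.im * ‖coeffC γ δ lam1‖ * |t| := by
    rw [Real.exp_add, Real.exp_add, Real.exp_log (by positivity), Real.exp_log hCn,
      Real.exp_log htn]
  rw [sub_eq_add_neg, Complex.exp_add, ← Complex.ofReal_exp, hreal, tauParam, hconj]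
  conv_lhs => rw [← hσ]
  push_cast
  ring

theorem antidiag_eq (N : ℕ) {γ δ : ℝ} {lam1 : ℂ} (hlam : 0 < lam1.im)
    (hC : coeffC γ δ lam1 ≠ 0) (a : ℕ → ℂ) {σ : ℝ} (x : ℝ) {t : ℝ} (hσ : σ * |t| = t)
    (hσ2 : σ ^ 2 = 1) (ht : t ≠ 0) (i : Fin N) :
    antidiag N γ δ lam1 a x t i = (((-1) ^ (i : ℕ) * (-σ) ^ (N - 1) : ℝ) : ℂ) *
      Complex.exp (logAntidiag N γ δ lam1 a x t i) := by
  have hi := i.2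
  obtain ⟨d, hd⟩ : ∃ d, N - 1 = (i : ℕ) + d := Nat.exists_eq_add_of_le (by omega)
  have hrev : (i.rev : ℕ) = d := by rw [Fin.val_rev]; omega
  have hN : (N : ℝ) - 1 - 2 * (i : ℕ) = (d : ℝ) - (i : ℕ) := by
    have : (N : ℝ) = (i : ℕ) + d + 1 := by exact_mod_cast (by omega : N = (i : ℕ) + d + 1)
    rw [this]; ring
  set p : ℂ := ((Real.log (2 * lam1.im) + Real.log ‖coeffC γ δ lam1‖ + Real.log |t| : ℝ)
        - Complex.I * (coeffC γ δ lam1).arg) with hp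
  have hlog : Complex.exp ((Real.log (((i : ℕ).factorial : ℝ) / (d.factorial : ℝ)) : ℝ) : ℂ) =
      ((i : ℕ).factorial : ℂ) / (d.factorial : ℂ) := by
    rw [← Complex.ofReal_exp, Real.exp_log (by positivity)]
    push_cast
    ring
  have hexp : Complex.exp (((d : ℝ) - (i : ℕ) : ℝ) * p) =
      Complex.exp p ^ d / Complex.exp p ^ (i : ℕ) := by
    rw [← Complex.exp_nat_mul, ← Complex.exp_nat_mul, ← Complex.exp_sub]
    congr 1
    push_cast
    ring
  have hσd : ((-σ : ℝ) : ℂ) ^ 2 = 1 := by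
    rw [← Complex.ofReal_pow, neg_sq, hσ2, Complex.ofReal_one]
  have hσ0 : ((-σ : ℝ) : ℂ) ≠ 0 := by
    intro h0
    rw [h0] at hσd
    norm_num at hσd
  have hσi : ((-σ : ℝ) : ℂ) ^ d / ((-σ : ℝ) : ℂ) ^ (i : ℕ) = ((-σ : ℝ) : ℂ) ^ (N - 1) := by
    rw [div_eq_iff (pow_ne_zero _ hσ0), hd, ← pow_add,
      show (i : ℕ) + d + i = 2 * i + d by ring, pow_add, pow_mul, hσd, one_pow, one_mul]
  have hsub : N - 1 - (i : ℕ) = d := by omega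
  rw [antidiag, scaleD, scaleD, hrev, tauParam_eq hlam hC hσ ht, ← hp, logAntidiag, hN, ← hp, hsub,
    Complex.exp_add, Complex.exp_add, hlog, hexp]
  push_cast
  push_cast at hσi
  rw [← hσi, mul_pow, mul_pow]
  push_cast at hσ0
  have hE := Complex.exp_ne_zero p
  have hf : (d.factorial : ℂ) ≠ 0 := by exact_mod_cast d.factorial_ne_zero
  field_simp

theorem sech_neg (y : ℝ) : sech (-y) = sech y := by
  rw [sech, sech, Real.cosh_neg]

theorem logAntidiag_re (N : ℕ) [NeZero N] (γ δ : ℝ) (lam1 : ℂ) (a : ℕ → ℂ) (x t : ℝ) (k : ℕ) :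
    (logAntidiag N γ δ lam1 a x t k).re =
      -2 * lam1.im * (x - velocity γ δ lam1 * t) + 2 * (a 0).re +
      ((N : ℝ) - 1 - 2 * k) *
        (Real.log (2 * lam1.im) + Real.log ‖coeffC γ δ lam1‖ + Real.log |t|) +
      Real.log ((k.factorial : ℝ) / ((N - 1 - k).factorial : ℝ)) := by
  have h := norm_exp_two_theta1 N γ δ lam1 a x t
  rw [Complex.norm_exp] at h
  have h2 := Real.exp_injective h
  rw [logAntidiag, Complex.add_re, Complex.add_re, h2, Complex.re_ofReal_mul, Complex.sub_re,
    Complex.ofReal_re, Complex.ofReal_re]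
  simp

theorem logAntidiag_im (N : ℕ) (γ δ : ℝ) (lam1 : ℂ) (a : ℕ → ℂ) (x t : ℝ) (k : ℕ) :
    (logAntidiag N γ δ lam1 a x t k).im =
      2 * (theta1 N γ δ lam1 a x t).im - ((N : ℝ) - 1 - 2 * k) * (coeffC γ δ lam1).arg := by
  rw [logAntidiag, Complex.add_im, Complex.add_im, Complex.im_ofReal_mul, Complex.sub_im,
    Complex.ofReal_im, Complex.ofReal_im]
  simp
  ring

theorem leadingTerm_eq_sum (N : ℕ) {γ δ : ℝ} {lam1 : ℂ} (hlam : 0 < lam1.im)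
    (hC : coeffC γ δ lam1 ≠ 0) (a : ℕ → ℂ) {σ : ℝ} (x : ℝ) {t : ℝ} (hσ : σ * |t| = t)
    (hσ2 : σ ^ 2 = 1) (ht : t ≠ 0) :
    leadingTerm N γ δ lam1 a x t = ∑ i : Fin N, -2 * Complex.I * lam1.im * (σ : ℂ) ^ (N - 1) *
      (-1) ^ (i : ℕ) * sech (logAntidiag N γ δ lam1 a x t i).re *
        Complex.exp (-(Complex.I * (logAntidiag N γ δ lam1 a x t i).im)) := by
  rw [leadingTerm, Finset.mul_sum]
  refine Finset.sum_congr rfl fun i _ => ?_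
  have hi := i.2
  have hsign : ((-1 : ℝ) ^ (i : ℕ) * (-σ) ^ (N - 1)) ^ 2 = 1 := by
    rw [mul_pow, ← pow_mul, ← pow_mul, mul_comm _ 2, mul_comm _ 2, pow_mul, pow_mul, neg_sq, neg_sq,
      hσ2]
    simp
  have halt : altVec N i.rev * altVec N i = (-1) ^ (N - 1) := by
    rw [altVec, altVec, ← pow_add, Fin.val_rev, show N - (i + 1) + (i : ℕ) = N - 1 by omega]
  rw [mul_comm (conj _), mul_div_assoc, ← mul_assoc (altVec N i.rev), halt,
    antidiag_eq N hlam hC a x hσ hσ2 ht, conj_div_one_add_sq _ hsign]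
  have h1 : ((-1 : ℂ)) ^ (N - 1) * (-(σ : ℂ)) ^ (N - 1) = (σ : ℂ) ^ (N - 1) := by
    rw [← mul_pow]; congr 1; ring
  push_cast
  rw [← h1]
  ring

theorem exp_left_phase (p : ℝ) (k : ℕ) :
    Complex.exp (Complex.I * (p + Real.pi * (1 / 2 + ((k + 1 : ℕ) : ℂ)))) =
      -Complex.I * (-1) ^ k * Complex.exp (Complex.I * p) := by
  have h : Complex.I * ((p : ℂ) + Real.pi * (1 / 2 + ((k + 1 : ℕ) : ℂ))) =
      Complex.I * p + (Real.pi / 2 * Complex.I + ((k + 1 : ℕ) : ℂ) * (Real.pi * Complex.I)) := by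
    ring
  rw [h, Complex.exp_add, Complex.exp_add, Complex.exp_pi_div_two_mul_I, Complex.exp_nat_mul,
    Complex.exp_pi_mul_I, pow_succ]
  ring

/-- For `t > 0`, the left soliton number `k + 1` belongs to the antidiagonal entry with index `k`. -/
theorem leftSoliton_pos (N : ℕ) [NeZero N] {γ δ : ℝ} {lam1 : ℂ} (hlam : 0 < lam1.im)
    (a : ℕ → ℂ) (x t : ℝ) (k : ℕ) :
    leftSoliton 1 N γ δ lam1 a (k + 1) x t = -2 * Complex.I * lam1.im *
      (-1) ^ k * sech (logAntidiag N γ δ lam1 a x t k).re *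
        Complex.exp (-(Complex.I * (logAntidiag N γ δ lam1 a x t k).im)) := by
  have harg : 2 * lam1.im * sLeft 1 N γ δ lam1 (k + 1) x t + 1 * shift N γ δ lam1 (k + 1)
      - 2 * (a 0).re = -(logAntidiag N γ δ lam1 a x t k).re := by
    rw [logAntidiag_re, sLeft, shift, show N - (k + 1) = N - 1 - k by omega, Nat.add_sub_cancel,
      Real.log_div (by positivity) (by positivity), Real.log_div (by positivity) (by positivity)]
    push_cast
    field_simp
    ring
  have hph : Complex.I * (-2 * (theta1 N γ δ lam1 a x t).im
      + (1 : ℝ) * ((N : ℝ) + 1 - 2 * ((k + 1 : ℕ) : ℝ)) * (coeffC γ δ lam1).arg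
      + Real.pi * (1 / 2 + ((k + 1 : ℕ) : ℂ))) =
      Complex.I * (((-(logAntidiag N γ δ lam1 a x t k).im : ℝ) : ℂ)
      + Real.pi * (1 / 2 + ((k + 1 : ℕ) : ℂ))) := by
    rw [logAntidiag_im]
    push_cast
    ring
  rw [leftSoliton, harg, sech_neg]
  push_cast at hph ⊢
  rw [hph]
  have := exp_left_phase (-(logAntidiag N γ δ lam1 a x t k).im) k
  push_cast at this
  rw [this, mul_neg]
  ring

/-- For `t < 0`, the order is reversed: the left soliton number `d + 1` belongs to the antidiagonal
entry with index `N - 1 - d`. -/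
theorem leftSoliton_neg (N : ℕ) [NeZero N] {γ δ : ℝ} {lam1 : ℂ} (hlam : 0 < lam1.im)
    (a : ℕ → ℂ) (x t : ℝ) (k d : ℕ) (hk : N - 1 = k + d) :
    leftSoliton (-1) N γ δ lam1 a (d + 1) x t = -2 * Complex.I * lam1.im *
      (-1) ^ (N - 1) * (-1) ^ k * sech (logAntidiag N γ δ lam1 a x t k).re *
        Complex.exp (-(Complex.I * (logAntidiag N γ δ lam1 a x t k).im)) := by
  have hN1 : 1 ≤ N := NeZero.one_le
  have hN : (N : ℝ) = k + d + 1 := by exact_mod_cast (by omega : N = k + d + 1)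
  have hNc : (N : ℂ) = k + d + 1 := by exact_mod_cast (by omega : N = k + d + 1)
  have harg : 2 * lam1.im * sLeft (-1) N γ δ lam1 (d + 1) x t + -1 * shift N γ δ lam1 (d + 1)
      - 2 * (a 0).re = -(logAntidiag N γ δ lam1 a x t k).re := by
    rw [logAntidiag_re, sLeft, shift, show N - (d + 1) = k by omega,
      show N - 1 - k = d by omega, Nat.add_sub_cancel,
      Real.log_div (by positivity) (by positivity), hN]
    push_cast
    field_simp
    ring
  have hph : Complex.I * (-2 * (theta1 N γ δ lam1 a x t).im
      + (-1 : ℝ) * ((N : ℝ) + 1 - 2 * ((d + 1 : ℕ) : ℝ)) * (coeffC γ δ lam1).arg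
      + Real.pi * (1 / 2 + ((d + 1 : ℕ) : ℂ))) =
      Complex.I * (((-(logAntidiag N γ δ lam1 a x t k).im : ℝ) : ℂ)
      + Real.pi * (1 / 2 + ((d + 1 : ℕ) : ℂ))) := by
    rw [logAntidiag_im, hN]
    push_cast
    ring
  have hsign : (-1 : ℂ) ^ (N - 1) * (-1) ^ k = (-1) ^ d := by
    rw [hk, ← pow_add, show k + d + k = 2 * k + d by ring, pow_add, pow_mul]
    simp
  rw [leftSoliton, harg, sech_neg]
  push_cast at hph ⊢
  rw [hph]
  have := exp_left_phase (-(logAntidiag N γ δ lam1 a x t k).im) d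
  push_cast at this
  rw [this, mul_neg, mul_assoc (-2 * Complex.I * (lam1.im : ℂ)), hsign]
  ring

/-- The right solitons continue the family of left solitons to the indices above
`(N + 1) / 2`. -/
theorem rightSoliton_eq_left (N : ℕ) (σ : ℝ) {γ δ : ℝ} {lam1 : ℂ} (a : ℕ → ℂ) (x t : ℝ) (κ : ℕ)
    (h1 : 1 ≤ κ) (h2 : κ ≤ N) :
    rightSoliton σ N γ δ lam1 a κ x t = leftSoliton σ N γ δ lam1 a (N + 1 - κ) x t := by
  obtain ⟨j, rfl⟩ : ∃ j, κ = j + 1 := ⟨κ - 1, by omega⟩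
  obtain ⟨l, rfl⟩ : ∃ l, N = j + 1 + l := Nat.exists_eq_add_of_le h2
  have hk : j + 1 + l + 1 - (j + 1) = l + 1 := by omega
  have harg : 2 * lam1.im * sRight σ (j + 1 + l) γ δ lam1 (j + 1) x t
      - σ * shift (j + 1 + l) γ δ lam1 (j + 1) - 2 * (a 0).re =
      2 * lam1.im * sLeft σ (j + 1 + l) γ δ lam1 (l + 1) x t
      + σ * shift (j + 1 + l) γ δ lam1 (l + 1) - 2 * (a 0).re := by
    rw [sRight, sLeft, shift, shift, show j + 1 + l - (j + 1) = l by omega,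
      show j + 1 + l - (l + 1) = j by omega, Nat.add_sub_cancel, Nat.add_sub_cancel,
      Real.log_div (by positivity) (by positivity), Real.log_div (by positivity) (by positivity)]
    push_cast
    ring
  rw [rightSoliton, leftSoliton, hk, harg]
  congr 1
  rw [Complex.exp_eq_exp_iff_exists_int]
  refine ⟨j, ?_⟩
  push_cast
  ring

theorem asymptoticSum_eq_sum (N : ℕ) (σ : ℝ) {γ δ : ℝ} {lam1 : ℂ} (a : ℕ → ℂ) (x t : ℝ) :
    asymptoticSum σ N γ δ lam1 a x t =
      ∑ i : Fin N, leftSoliton σ N γ δ lam1 a ((i : ℕ) + 1) x t := by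
  rw [Fin.sum_univ_eq_sum_range (fun i => leftSoliton σ N γ δ lam1 a (i + 1) x t) N]
  rw [asymptoticSum]
  have e1 : ∑ κ ∈ Finset.Icc 1 ((N + 1) / 2), leftSoliton σ N γ δ lam1 a κ x t =
      ∑ i ∈ Finset.range ((N + 1) / 2), leftSoliton σ N γ δ lam1 a (i + 1) x t := by
    rw [Finset.range_eq_Ico, Finset.sum_Ico_add' (fun κ => leftSoliton σ N γ δ lam1 a κ x t)]
    rfl
  have e2 : ∑ κ ∈ Finset.Icc 1 (N / 2), rightSoliton σ N γ δ lam1 a κ x t =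
      ∑ i ∈ Finset.range (N / 2), leftSoliton σ N γ δ lam1 a ((N + 1) / 2 + i + 1) x t := by
    have h1 : ∑ κ ∈ Finset.Icc 1 (N / 2), rightSoliton σ N γ δ lam1 a κ x t =
        ∑ i ∈ Finset.range (N / 2), rightSoliton σ N γ δ lam1 a (i + 1) x t := by
      rw [Finset.range_eq_Ico, Finset.sum_Ico_add' (fun κ => rightSoliton σ N γ δ lam1 a κ x t)]
      rfl
    rw [h1, ← Finset.sum_range_reflect]
    refine Finset.sum_congr rfl fun i hi => ?_
    have hi' : i < N / 2 := by simpa using hi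
    rw [rightSoliton_eq_left N σ a x t _ (by omega) (by omega)]
    congr 1
    omega
  rw [e1, e2, ← Finset.sum_range_add]
  congr 2
  omega

theorem leadingTerm_eq_asymptoticSum_pos (N : ℕ) [NeZero N] {γ δ : ℝ} {lam1 : ℂ}
    (hlam : 0 < lam1.im) (hC : coeffC γ δ lam1 ≠ 0) (a : ℕ → ℂ) (x : ℝ) {t : ℝ} (ht : 0 < t) :
    leadingTerm N γ δ lam1 a x t = asymptoticSum 1 N γ δ lam1 a x t := by
  rw [leadingTerm_eq_sum N hlam hC a (σ := 1) x (by rw [abs_of_pos ht, one_mul]) (by norm_num)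
    ht.ne', asymptoticSum_eq_sum]
  refine Finset.sum_congr rfl fun i _ => ?_
  rw [leftSoliton_pos N hlam a x t i]
  simp

theorem leadingTerm_eq_asymptoticSum_neg (N : ℕ) [NeZero N] {γ δ : ℝ} {lam1 : ℂ}
    (hlam : 0 < lam1.im) (hC : coeffC γ δ lam1 ≠ 0) (a : ℕ → ℂ) (x : ℝ) {t : ℝ} (ht : t < 0) :
    leadingTerm N γ δ lam1 a x t = asymptoticSum (-1) N γ δ lam1 a x t := by
  rw [leadingTerm_eq_sum N hlam hC a (σ := -1) x (by rw [abs_of_neg ht]; ring) (by norm_num)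
    ht.ne, asymptoticSum_eq_sum, ← Equiv.sum_comp Fin.revPerm]
  refine Finset.sum_congr rfl fun i _ => ?_
  have hi := i.2
  rw [leftSoliton_neg N hlam a x t (Fin.revPerm i : Fin N) i (by
    rw [Fin.revPerm_apply, Fin.val_rev]; omega)]
  simp

end Hirota

end

theorem theorem4p6 (N : ℕ) [NeZero N] (γ δ : ℝ) (hγδ : γ ≠ 0 ∨ δ ≠ 0)
    (lam1 : ℂ) (hlam : 0 < lam1.im) (a : ℕ → ℂ) :
    (∀ x t : ℝ, (Hirota.matM N γ δ lam1 a x t).det ≠ 0) ∧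
    ∃ C T : ℝ, 1 < T ∧
      (∀ x t : ℝ, T ≤ t →
        ‖Hirota.soliton N γ δ lam1 a x t - Hirota.asymptoticSum 1 N γ δ lam1 a x t‖
          ≤ C * (Real.log |t| / |t|)) ∧
      (∀ x t : ℝ, t ≤ -T →
        ‖Hirota.soliton N γ δ lam1 a x t - Hirota.asymptoticSum (-1) N γ δ lam1 a x t‖
          ≤ C * (Real.log |t| / |t|)) := by
  have hC := Hirota.coeffC_ne_zero hγδ hlam
  refine ⟨Hirota.det_matM_ne_zero N γ δ lam1 hlam.ne' a, ?_⟩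
  obtain ⟨C, T, h⟩ := Hirota.soliton_sub_leadingTerm_bound N hlam hC a
  refine ⟨C, max T 2, lt_max_of_lt_right one_lt_two, fun x t ht => ?_, fun x t ht => ?_⟩
  · have ht2 : 2 ≤ t := (le_max_right _ _).trans ht
    have ht0 : 0 < t := by linarith
    rw [← Hirota.leadingTerm_eq_asymptoticSum_pos N hlam hC a x ht0]
    exact h x t (by rw [abs_of_pos ht0]; exact (le_max_left _ _).trans ht)
  · have ht2 : t ≤ -2 := ht.trans (neg_le_neg (le_max_right _ _))
    have ht0 : t < 0 := by linarith
    rw [← Hirota.leadingTerm_eq_asymptoticSum_neg N hlam hC a x ht0]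
    exact h x t (by
      rw [abs_of_neg ht0]
      linarith [le_max_left T 2])
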